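/- Let $P_0$ be a probability measure on $\mathbb R$ with Lebesgue density $p_0$, and let $X_1, X_2, \ldots$ be i.i.d. with law $P_0$. Let $\mathcal F$ be a collection of probability measures $P$ on $\mathbb R$ with Lebesgue densities $p$, equipped with the Borel $\sigma$-algebra of the weak topology and such that $(P,x)\mapsto p(x)$ is jointly measurable. For each $n$ let $\Pi_n$ be a probability measure on $\mathcal F$ (the prior), with posterior $$\Pi_n(A \mid X_1,\ldots,X_n) = \frac{\int_A \prod_{i=1}^n \frac{p(X_i)}{p_0(X_i)}\, d\Pi_n(P)}{\int_{\mathcal F} \prod_{i=1}^n \frac{p(X_i)}{p_0(X_i)}\, d\Pi_n(P)}, \qquad A \subset \mathcal F .$$ Write $M_q(P) = \int |x|^q\, dP(x)$, and let $W_1(P,Q) = \inf_\pi \int |x-y|\, d\pi(x,y)$, the infimum being over all couplings $\pi$ of $P$ and $Q$. Theorem (Convergence rate, $p = 1$). Let $(\epsilon_n)_{n\ge 1}$ be a non-increasing sequence with $\epsilon_n \to 0$ and $\epsilon_n \geq \sqrt{(\log n)/n}$ for all $n \ge 1$, and assume that for all large enough $n$ $$\Pi_n\Big(P \in \mathcal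 F : \int \log \frac{p_0}{p}\, dP_0 \leq \epsilon_n^2,\ \int \Big(\log \frac{p_0}{p}\Big)^2 dP_0 \leq \epsilon_n^2\Big) \geq e^{-n\epsilon_n^2}.$$ Assume further that there are constants $K, \delta > 0$ such that $M_{2+\delta}(P_0) < \infty$ and $\Pi_n(M_{2+\delta}(P) \leq K \mid X_1,\ldots,X_n) \to 1$ in probability as $n \to \infty$. Then there is a constant $K' > 0$ such that $$\Pi_n\Big(W_1(P,P_0) \geq K' \epsilon_n \log \epsilon_n^{-1} \,\Big|\, X_1,\ldots,X_n\Big) \longrightarrow 0 \quad \text{in probability as } n \to \infty .$$ -/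

import Mathlib

open MeasureTheory ProbabilityTheory Filter Topology
open scoped ENNReal

noncomputable section

namespace PosteriorRate

/-- The absolute moment `M_q(P) = ∫ |x|^q dP(x)`, with values in `[0, ∞]`. -/
def absMoment (q : ℝ) (P : Measure ℝ) : ℝ≥0∞ :=
  ∫⁻ x, ENNReal.ofReal (|x| ^ q) ∂P

/-- The couplings of `P` and `Q`: Borel probability measures on `ℝ × ℝ` with marginals `P`, `Q`. -/
def couplings (P Q : Measure ℝ) : Set (Measure (ℝ × ℝ)) :=
  {γ | IsProbabilityMeasure γ ∧ γ.map Prod.fst = P ∧ γ.map Prod.snd = Q}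

/-- The Wasserstein distance `W_p(P, Q)` of order `p`, with values in `[0, ∞]`. -/
def wasserstein (p : ℝ) (P Q : Measure ℝ) : ℝ≥0∞ :=
  ⨅ γ ∈ couplings P Q, (∫⁻ z, ENNReal.ofReal (|z.1 - z.2| ^ p) ∂γ) ^ (1 / p)

/-- `f` is a (nonnegative, Borel) Lebesgue density of `P`. -/
structure IsDensity (f : ℝ → ℝ) (P : Measure ℝ) : Prop where
  measurable : Measurable f
  nonneg : ∀ x, 0 ≤ f x
  eq_withDensity : P = volume.withDensity (fun x => ENNReal.ofReal (f x))

/-- `f P` is a density of `P` for each `P` in the family `F`, and `(P, x) ↦ f P x` is jointly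
measurable. The σ-algebra on `F` is the trace of the one on `ProbabilityMeasure ℝ` generated by
the evaluations `P ↦ P B`, which is the Borel σ-algebra of the weak topology. -/
structure IsDensityFamily {F : Set (ProbabilityMeasure ℝ)} (f : F → ℝ → ℝ) : Prop where
  measurable_uncurry : Measurable (Function.uncurry f)
  isDensity : ∀ P : F, IsDensity (f P) ((P : ProbabilityMeasure ℝ) : Measure ℝ)

/-- The likelihood ratio `∏ i, f P (x i) / f₀ (x i)` of the observations `x` at `P`. -/
def likelihoodRatio {F : Set (ProbabilityMeasure ℝ)} (f : F → ℝ → ℝ) (f₀ : ℝ → ℝ)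
    {n : ℕ} (x : Fin n → ℝ) (P : F) : ℝ≥0∞ :=
  ENNReal.ofReal (∏ i, f P (x i) / f₀ (x i))

/-- The posterior probability `Π(A ∣ x₁, …, xₙ)` given by Bayes' formula. -/
def posterior {F : Set (ProbabilityMeasure ℝ)} (f : F → ℝ → ℝ) (f₀ : ℝ → ℝ)
    (prior : Measure F) {n : ℕ} (x : Fin n → ℝ) (A : Set F) : ℝ :=
  ((∫⁻ P in A, likelihoodRatio f f₀ x P ∂prior) /
    (∫⁻ P, likelihoodRatio f f₀ x P ∂prior)).toReal

/-- `∫ (log (f₀ / g))² dP₀` with values in `[0, ∞]`; here `log 0 = -∞` and `log ∞ = ∞`, so that the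
integrand is `∞` where `g` vanishes and `f₀` does not. -/
def klSecondMoment (P₀ : Measure ℝ) (f₀ g : ℝ → ℝ) : ℝ≥0∞ :=
  ∫⁻ x, (ENNReal.log (ENNReal.ofReal (f₀ x) / ENNReal.ofReal (g x))).abs ^ 2 ∂P₀

/-- The Kullback-Leibler type neighbourhood of `P₀` of radius `ε`: all `P` in the family with
`∫ log (p₀ / p) dP₀ ≤ ε²` and `∫ (log (p₀ / p))² dP₀ ≤ ε²`. -/
def klNeighbourhood {F : Set (ProbabilityMeasure ℝ)} (f : F → ℝ → ℝ)
    (P₀ : Measure ℝ) (f₀ : ℝ → ℝ) (ε : ℝ) : Set F :=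
  {P | InformationTheory.klDiv P₀ ((P : ProbabilityMeasure ℝ) : Measure ℝ)
        ≤ ENNReal.ofReal (ε ^ 2) ∧
      klSecondMoment P₀ f₀ (f P) ≤ ENNReal.ofReal (ε ^ 2)}

/-- The Kullback-Leibler rate condition: `Π_n(K_n) ≥ exp(-n ε_n²)` for all large enough `n`. -/
def KLRateCondition {F : Set (ProbabilityMeasure ℝ)} (f : F → ℝ → ℝ) (P₀ : Measure ℝ)
    (f₀ : ℝ → ℝ) (prior : ℕ → Measure F) (ε : ℕ → ℝ) : Prop :=
  ∀ᶠ n : ℕ in atTop,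
    ENNReal.ofReal (Real.exp (-(n * ε n ^ 2))) ≤ prior n (klNeighbourhood f P₀ f₀ (ε n))

end PosteriorRate

end

namespace PosteriorRate

/-! On the line, `W_1` is at most the area between the distribution functions
(`wasserstein_one_le_lintegral_cdf`), so it suffices to compare `P` and `P₀` on half-lines. If the
second moments are bounded, the indicator of a half-line ending at `±y` has variance `O(w²)` with `w
= 1/(1+y)`. Counting observations in it then detects a discrepancy of order `εw + ε²` with errors
`exp(-C n ε²)`, by a Chernoff bound with variance proxy. Closeness on the grid `±kε`, `k ≤ ⌈ε⁻²⌉`,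
suffices (`wasserstein_one_le_of_grid`): the mesh `ε` times the harmonic-type sum of `ε/(1+kε)`
gives `ε log ε⁻¹`, the `ε²` terms add up to `O(ε)`, and the tails beyond `1/ε` are `O(ε)` by
Chebyshev.

The statistical side is `measure_mul_lintegral_le_setLIntegral_le`. The Kullback-Leibler condition
makes the denominator of the posterior at least `exp(-3nε²)/2` with high probability, while the
tests make the numerator over each set of `P` with excess mass on a half-line of order `exp(-6nε²)`
in mean. There are only `O(ε⁻²) = O(n)` half-lines, and `nε² ≥ log n`, so a union bound over them
suffices, with no entropy condition on `F`. -/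

/-! ### Quantile coupling on the line -/

/-- The quantile function of `P`. -/
noncomputable def quantile (P : Measure ℝ) (u : ℝ) : ℝ := sInf {x | u ≤ cdf P x}

/-- Right-continuity of the distribution function makes the infimum attained, so `quantile` and
`cdf` form a Galois connection on `(0, 1)`. -/
theorem quantile_le_iff (P : Measure ℝ) {u : ℝ} (hu : u ∈ Set.Ioo (0 : ℝ) 1) (x : ℝ) :
    quantile P u ≤ x ↔ u ≤ cdf P x := by
  have hne : {x | u ≤ cdf P x}.Nonempty :=
    ((tendsto_cdf_atTop P).eventually (eventually_ge_nhds hu.2)).exists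
  have hbdd : BddBelow {x | u ≤ cdf P x} := by
    obtain ⟨y, hy⟩ := ((tendsto_cdf_atBot P).eventually (eventually_lt_nhds hu.1)).exists
    refine ⟨y, fun z hz => ?_⟩
    by_contra! h
    exact absurd (hz.trans (monotone_cdf P h.le)) (not_le.2 hy)
  refine ⟨fun h => ?_, fun h => csInf_le hbdd h⟩
  have hright : Tendsto (cdf P) (𝓝[>] x) (𝓝 (cdf P x)) :=
    ((cdf P).right_continuous x).tendsto.mono_left (nhdsWithin_mono x Set.Ioi_subset_Ici_self)
  refine ge_of_tendsto hright ?_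
  filter_upwards [self_mem_nhdsWithin] with y hy
  obtain ⟨z, hz, hzy⟩ := exists_lt_of_csInf_lt hne (lt_of_le_of_lt h hy)
  exact le_trans (show u ≤ cdf P z from hz) (monotone_cdf P hzy.le)

theorem aemeasurable_quantile (P : Measure ℝ) :
    AEMeasurable (quantile P) (volume.restrict (Set.Ioo (0 : ℝ) 1)) := by
  refine aemeasurable_restrict_of_monotoneOn measurableSet_Ioo fun u hu v hv huv => ?_
  rw [quantile_le_iff P hu]
  exact huv.trans ((quantile_le_iff P hv _).1 le_rfl)

theorem map_quantile (P : Measure ℝ) [IsProbabilityMeasure P] :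
    (volume.restrict (Set.Ioo (0 : ℝ) 1)).map (quantile P) = P := by
  have : IsFiniteMeasure (volume.restrict (Set.Ioo (0 : ℝ) 1)) := ⟨by simp⟩
  refine Measure.ext_of_Iic _ _ fun x => ?_
  rw [Measure.map_apply_of_aemeasurable (aemeasurable_quantile P) measurableSet_Iic,
    Measure.restrict_apply₀' measurableSet_Ioo.nullMeasurableSet]
  have h : quantile P ⁻¹' Set.Iic x ∩ Set.Ioo 0 1 = Set.Iic (cdf P x) ∩ Set.Ioo 0 1 := by
    ext u
    simp only [Set.mem_inter_iff, Set.mem_preimage, Set.mem_Iic]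
    exact and_congr_left fun hu => quantile_le_iff P hu x
  rw [h, ← ofReal_cdf]
  refine le_antisymm ?_ ?_
  · refine (measure_mono (t := Set.Ioc 0 (cdf P x)) fun u hu => ⟨hu.2.1, hu.1⟩).trans ?_
    simp
  · refine le_trans ?_ (measure_mono (s := Set.Ioo 0 (cdf P x))
      fun u hu => ⟨hu.2.le, hu.1, hu.2.trans_le (cdf_le_one P x)⟩)
    simp

/-- The quantile coupling costs the area between the two quantile functions. By Fubini this is the
area between the distribution functions, the same region sliced the other way. -/
theorem wasserstein_one_le_lintegral_cdf (P Q : Measure ℝ) [IsProbabilityMeasure P]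
    [IsProbabilityMeasure Q] :
    wasserstein 1 P Q ≤ ∫⁻ x, ENNReal.ofReal |cdf P x - cdf Q x| := by
  set l : Measure ℝ := volume.restrict (Set.Ioo (0 : ℝ) 1) with hl
  have hlp : IsProbabilityMeasure l := ⟨by simp [hl]⟩
  have hm : AEMeasurable (fun u => (quantile P u, quantile Q u)) l :=
    (aemeasurable_quantile P).prodMk (aemeasurable_quantile Q)
  have hcoup : l.map (fun u => (quantile P u, quantile Q u)) ∈ couplings P Q := by
    refine ⟨Measure.isProbabilityMeasure_map hm, ?_, ?_⟩
    · rw [AEMeasurable.map_map_of_aemeasurable measurable_fst.aemeasurable hm]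
      exact map_quantile P
    · rw [AEMeasurable.map_map_of_aemeasurable measurable_snd.aemeasurable hm]
      exact map_quantile Q
  -- The pairs `(u, x)` with `u` between the two distribution functions at `x`. By
  -- `quantile_le_iff`, the section at `u` is the interval between the two quantiles.
  set S : Set (ℝ × ℝ) := {z | z.1 ∈ Set.Ioc (min (cdf P z.2) (cdf Q z.2))
    (max (cdf P z.2) (cdf Q z.2))} with hS
  have hFm : Measurable (cdf P) := (monotone_cdf P).measurable
  have hGm : Measurable (cdf Q) := (monotone_cdf Q).measurable
  have hSm : MeasurableSet S := by
    refine MeasurableSet.inter (measurableSet_lt ?_ measurable_fst)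
      (measurableSet_le measurable_fst ?_)
    · exact (hFm.comp measurable_snd).min (hGm.comp measurable_snd)
    · exact (hFm.comp measurable_snd).max (hGm.comp measurable_snd)
  refine (iInf₂_le _ hcoup).trans ?_
  rw [lintegral_map' (by fun_prop) hm, div_one, ENNReal.rpow_one]
  calc ∫⁻ u, ENNReal.ofReal (|quantile P u - quantile Q u| ^ (1 : ℝ)) ∂l
      = ∫⁻ u, (∫⁻ x, S.indicator 1 (u, x)) ∂l := by
        rw [hl]
        refine setLIntegral_congr_fun measurableSet_Ioo fun u hu => ?_
        have h1 : ∀ x, S.indicator (1 : ℝ × ℝ → ℝ≥0∞) (u, x)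
            = (Set.Ico (min (quantile P u) (quantile Q u))
              (max (quantile P u) (quantile Q u))).indicator 1 x := by
          intro x
          simp only [Set.indicator, hS, Set.mem_ofPred_eq, Set.mem_Ioc, Set.mem_Ico, ← not_le,
            le_min_iff, max_le_iff, le_max_iff, min_le_iff, quantile_le_iff _ hu]
          congr 1
          simp only [eq_iff_iff]
          tauto
        simp only [h1]
        rw [lintegral_indicator_one measurableSet_Ico, Real.volume_Ico, max_sub_min_eq_abs',
          Real.rpow_one]
    _ = ∫⁻ x, (∫⁻ u, S.indicator 1 (u, x) ∂l) :=
        lintegral_lintegral_swap (f := fun u x => S.indicator 1 (u, x))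
          (measurable_one.indicator hSm).aemeasurable
    _ ≤ ∫⁻ x, ENNReal.ofReal |cdf P x - cdf Q x| := by
        refine lintegral_mono fun x => ?_
        refine (lintegral_mono' Measure.restrict_le_self le_rfl).trans ?_
        have h1 : ∀ u, S.indicator (1 : ℝ × ℝ → ℝ≥0∞) (u, x)
            = (Set.Ioc (min (cdf P x) (cdf Q x)) (max (cdf P x) (cdf Q x))).indicator 1 u :=
          fun u => rfl
        simp only [h1]
        rw [lintegral_indicator_one measurableSet_Ioc, Real.volume_Ioc, max_sub_min_eq_abs']

/-! ### Area between monotone functions from their values on a grid -/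

/-- Monotonicity traps the difference inside a cell between the endpoint errors and the increment of
`v`, which telescopes over cells. -/
theorem setLIntegral_Ioc_abs_sub_le_of_monotone {u v : ℝ → ℝ} (hu : Monotone u) (hv : Monotone v)
    {a b : ℝ} (hab : a ≤ b) :
    ∫⁻ x in Set.Ioc a b, ENNReal.ofReal |u x - v x| ≤
      ENNReal.ofReal ((b - a) * (|u a - v a| + |u b - v b| + (v b - v a))) := by
  calc ∫⁻ x in Set.Ioc a b, ENNReal.ofReal |u x - v x|
      ≤ ∫⁻ _ in Set.Ioc a b, ENNReal.ofReal (|u a - v a| + |u b - v b| + (v b - v a)) := by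
        refine setLIntegral_mono measurable_const fun x hx => ENNReal.ofReal_le_ofReal ?_
        have h1 := hu hx.1.le
        have h2 := hu hx.2
        have h3 := hv hx.1.le
        have h4 := hv hx.2
        have h5 := neg_abs_le (u a - v a)
        have h6 := le_abs_self (u b - v b)
        have h7 := abs_nonneg (u a - v a)
        have h8 := abs_nonneg (u b - v b)
        exact abs_le.2 ⟨by linarith, by linarith⟩
    _ = _ := by
        rw [setLIntegral_const, Real.volume_Ioc, mul_comm, ENNReal.ofReal_mul (sub_nonneg.2 hab)]

theorem setLIntegral_Ioc_abs_sub_le_sum {u v : ℝ → ℝ} (hu : Monotone u) (hv : Monotone v)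
    {ε : ℝ} (hε : 0 ≤ ε) {B : ℕ → ℝ} (hB : Antitone B) (m : ℕ)
    (h : ∀ k ≤ m, |u (k * ε) - v (k * ε)| ≤ B k) :
    ∫⁻ x in Set.Ioc 0 (m * ε), ENNReal.ofReal |u x - v x| ≤
      ENNReal.ofReal (2 * ε * ∑ k ∈ Finset.range m, B k + ε * (v (m * ε) - v 0)) := by
  induction m with
  | zero => simp
  | succ m ih =>
    have hle : (m : ℝ) * ε ≤ ((m + 1 : ℕ) : ℝ) * ε := by gcongr; simp
    have h0 : 0 ≤ (m : ℝ) * ε := by positivity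
    have hpos : 0 ≤ 2 * ε * ∑ k ∈ Finset.range m, B k + ε * (v (m * ε) - v 0) := by
      have h1 : 0 ≤ ∑ k ∈ Finset.range m, B k := Finset.sum_nonneg fun k hk =>
        (abs_nonneg _).trans (h k (by have := Finset.mem_range.1 hk; omega))
      have h2 := hv h0
      have : 0 ≤ v (m * ε) - v 0 := by linarith
      positivity
    have hstep := setLIntegral_Ioc_abs_sub_le_of_monotone hu hv hle
    have h1 := h m (by omega)
    -- Since `B` decreases, the error at the right endpoint is also at most `B m`; hence the factor
    -- `2`.
    have h2 := (h (m + 1) le_rfl).trans (hB (Nat.le_succ m))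
    have hpos2 : 0 ≤ |u (m * ε) - v (m * ε)| +
        |u ((m + 1 : ℕ) * ε) - v ((m + 1 : ℕ) * ε)| + (v ((m + 1 : ℕ) * ε) - v (m * ε)) := by
      have := hv hle
      have := abs_nonneg (u (m * ε) - v (m * ε))
      have := abs_nonneg (u ((m + 1 : ℕ) * ε) - v ((m + 1 : ℕ) * ε))
      linarith
    have hw : ((m + 1 : ℕ) : ℝ) * ε - m * ε = ε := by push_cast; ring
    rw [hw] at hstep
    rw [← Set.Ioc_union_Ioc_eq_Ioc h0 hle]
    refine (lintegral_union_le _ _ _).trans ((add_le_add (ih fun k hk => h k (by omega))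
      hstep).trans ?_)
    rw [← ENNReal.ofReal_add hpos (mul_nonneg hε hpos2)]
    refine ENNReal.ofReal_le_ofReal ?_
    rw [Finset.sum_range_succ]
    nlinarith [mul_le_mul_of_nonneg_left (add_le_add h1 h2) hε]

/-- Each summand `y ≤ 1` satisfies `y/2 ≤ log (1 + y)`, and `1 + y` is the ratio of consecutive
arguments of the logarithm. -/
theorem sum_div_one_add_mul_le {ε : ℝ} (hε : 0 ≤ ε) (hε1 : ε ≤ 1) (m : ℕ) :
    ∑ k ∈ Finset.range m, ε / (1 + k * ε) ≤ 2 * Real.log (1 + m * ε) := by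
  induction m with
  | zero => simp
  | succ m ih =>
    rw [Finset.sum_range_succ]
    have h0 : 0 < 1 + (m : ℝ) * ε := by positivity
    set y := ε / (1 + m * ε) with hy
    have hy0 : 0 ≤ y := by positivity
    have hy1 : y ≤ 1 := (div_le_self hε (by nlinarith)).trans hε1
    have h1 : 1 + ((m + 1 : ℕ) : ℝ) * ε = (1 + m * ε) * (1 + y) := by
      rw [hy]; push_cast; field_simp; ring
    rw [h1, Real.log_mul h0.ne' (by positivity)]
    have h2 := Real.one_sub_inv_le_log_of_pos (show 0 < 1 + y by positivity)
    have h3 : y / 2 ≤ 1 - (1 + y)⁻¹ := by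
      have : 1 - (1 + y)⁻¹ = y / (1 + y) := by field_simp; ring
      rw [this]
      gcongr
      linarith
    linarith

theorem setLIntegral_Ioi_div_sq {V R : ℝ} (hV : 0 ≤ V) (hR : 0 < R) :
    ∫⁻ x in Set.Ioi R, ENNReal.ofReal (V / x ^ 2) = ENNReal.ofReal (V / R) := by
  have h : ∀ x : ℝ, V / x ^ 2 = V * x ^ (-2 : ℝ) := fun x => by
    rw [div_eq_mul_inv, show (-2 : ℝ) = ((-2 : ℤ) : ℝ) by norm_num, Real.rpow_intCast]
    simp [zpow_neg, zpow_ofNat]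
  rw [← ofReal_integral_eq_lintegral_ofReal]
  · simp only [h]
    rw [integral_const_mul, integral_Ioi_rpow_of_lt (by norm_num) hR]
    norm_num [Real.rpow_neg_one]
    rw [div_eq_mul_inv]
  · simp only [h]
    exact (integrableOn_Ioi_rpow_of_lt (by norm_num) hR).const_mul V
  · exact ae_of_all _ fun x => by positivity

/-- The integral is cut at the last grid point `mε ≥ 1/ε`: grid bound before it, quadratic tail
bound after it. -/
theorem setLIntegral_Ioi_abs_sub_le {u v : ℝ → ℝ} (hu : Monotone u) (hv : Monotone v)
    {V c ε : ℝ} (hV : 0 ≤ V) (hc : 0 ≤ c) (hε : 0 < ε) (hε1 : ε ≤ Real.exp (-1))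
    (htail : ∀ x, 0 < x → |u x - v x| ≤ V / x ^ 2) (hv1 : ∀ x, v x - v 0 ≤ 1)
    (h : ∀ k ≤ ⌈(ε ^ 2)⁻¹⌉₊, |u (k * ε) - v (k * ε)| ≤ c * (ε / (1 + k * ε) + ε ^ 2)) :
    ∫⁻ x in Set.Ioi 0, ENNReal.ofReal |u x - v x| ≤
      ENNReal.ofReal ((16 * c + 1 + V) * (ε * Real.log ε⁻¹)) := by
  set m := ⌈(ε ^ 2)⁻¹⌉₊ with hm
  have hm1 : (ε ^ 2)⁻¹ ≤ m := Nat.le_ceil _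
  have hm2 : (m : ℝ) < (ε ^ 2)⁻¹ + 1 := Nat.ceil_lt_add_one (by positivity)
  have hL : 1 ≤ Real.log ε⁻¹ := by
    rw [Real.log_inv]
    have := Real.log_le_log hε hε1
    rw [Real.log_exp] at this
    linarith
  have he1 : ε ≤ 1 := hε1.trans (by simp)
  set l := Real.log ε⁻¹ with hl
  have hR1 : ε⁻¹ ≤ m * ε := by
    calc ε⁻¹ = (ε ^ 2)⁻¹ * ε := by field_simp
      _ ≤ m * ε := by gcongr
  have hR2 : (m : ℝ) * ε ≤ ε⁻¹ + ε := by
    calc (m : ℝ) * ε ≤ ((ε ^ 2)⁻¹ + 1) * ε := by gcongr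
      _ = ε⁻¹ + ε := by field_simp
  have hei : 1 ≤ ε⁻¹ := (one_le_inv₀ hε).2 he1
  have hR0 : 0 < (m : ℝ) * ε := by positivity
  have hanti : Antitone fun k : ℕ => c * (ε / (1 + k * ε) + ε ^ 2) := by
    intro j k hjk
    dsimp only
    gcongr
  have hmid := setLIntegral_Ioc_abs_sub_le_sum hu hv hε.le hanti m h
  have htl : ∫⁻ x in Set.Ioi (m * ε), ENNReal.ofReal |u x - v x| ≤ ENNReal.ofReal (V * ε) := by
    calc ∫⁻ x in Set.Ioi (m * ε), ENNReal.ofReal |u x - v x|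
        ≤ ∫⁻ x in Set.Ioi (m * ε), ENNReal.ofReal (V / x ^ 2) :=
          setLIntegral_mono' measurableSet_Ioi fun x hx =>
            ENNReal.ofReal_le_ofReal (htail x (hR0.trans hx))
      _ = ENNReal.ofReal (V / (m * ε)) := setLIntegral_Ioi_div_sq hV hR0
      _ ≤ ENNReal.ofReal (V * ε) := by
          refine ENNReal.ofReal_le_ofReal ?_
          rw [div_eq_mul_inv]
          gcongr
          exact (inv_le_comm₀ hε hR0).1 hR1
  -- Here `1 + mε ≤ 3/ε ≤ e²/ε`, and `2 + l ≤ 3l` since `l ≥ 1`.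
  have hlog : Real.log (1 + m * ε) ≤ 3 * l := by
    have h3 : Real.log (1 + m * ε) ≤ Real.log (Real.exp 2 * ε⁻¹) := by
      refine Real.log_le_log (by positivity) ?_
      have : (3 : ℝ) ≤ Real.exp 2 := by linarith [Real.add_one_le_exp (2 : ℝ)]
      nlinarith
    rw [Real.log_mul (Real.exp_pos _).ne' (by positivity), Real.log_exp] at h3
    linarith
  -- The constant is `8 = 2·3 + 2`: `6l` from the harmonic part and `mε² ≤ 2 ≤ 2l` from the rest.
  have hsum : ∑ k ∈ Finset.range m, c * (ε / (1 + k * ε) + ε ^ 2) ≤ c * (8 * l) := by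
    rw [← Finset.mul_sum, Finset.sum_add_distrib, Finset.sum_const, Finset.card_range,
      nsmul_eq_mul]
    have h4 := sum_div_one_add_mul_le hε.le he1 m
    have h5 : (m : ℝ) * ε ^ 2 ≤ 2 := by nlinarith [mul_inv_cancel₀ hε.ne']
    gcongr
    linarith
  rw [← Set.Ioc_union_Ioi_eq_Ioi hR0.le]
  refine (lintegral_union_le _ _ _).trans ((add_le_add hmid htl).trans ?_)
  have hs0 : 0 ≤ ∑ k ∈ Finset.range m, c * (ε / (1 + k * ε) + ε ^ 2) :=
    Finset.sum_nonneg fun k _ => by positivity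
  have hv0 : 0 ≤ v (m * ε) - v 0 := sub_nonneg.2 (hv hR0.le)
  rw [← ENNReal.ofReal_add (by positivity) (by positivity)]
  refine ENNReal.ofReal_le_ofReal ?_
  have h6 := hv1 (m * ε)
  calc 2 * ε * ∑ k ∈ Finset.range m, c * (ε / (1 + k * ε) + ε ^ 2) +
        ε * (v (m * ε) - v 0) + V * ε
      ≤ 2 * ε * (c * (8 * l)) + ε * 1 + V * ε := by gcongr
    _ ≤ 2 * ε * (c * (8 * l)) + ε * l + V * (ε * l) := by
        gcongr
        exact le_mul_of_one_le_right hε.le hL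
    _ = _ := by ring

/-! ### Second moments, tails and the deterministic Wasserstein bound -/

/-- The second moment `∫ x² dP`. -/
noncomputable def secondMoment (P : Measure ℝ) : ℝ≥0∞ := ∫⁻ x, ENNReal.ofReal (x ^ 2) ∂P

theorem measureReal_le_secondMoment_div {P : Measure ℝ} {V : ℝ}
    (hV : 0 ≤ V) (h : secondMoment P ≤ ENNReal.ofReal V) {S : Set ℝ} {x : ℝ} (hx : x ≠ 0)
    (hS : ∀ y ∈ S, x ^ 2 ≤ y ^ 2) : P.real S ≤ V / x ^ 2 := by
  have hx2 : 0 < x ^ 2 := by positivity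
  have h1 : P S ≤ ENNReal.ofReal V / ENNReal.ofReal (x ^ 2) := by
    refine (measure_mono (t := {y | ENNReal.ofReal (x ^ 2) ≤ ENNReal.ofReal (y ^ 2)})
      fun y hy => ENNReal.ofReal_le_ofReal (hS y hy)).trans ?_
    refine (meas_ge_le_lintegral_div (by fun_prop) (by simpa using hx)
      ENNReal.ofReal_ne_top).trans ?_
    gcongr
    exact h
  rw [← ENNReal.ofReal_div_of_pos hx2] at h1
  exact ENNReal.toReal_le_of_le_ofReal (by positivity) h1

/-- By Chebyshev both tail masses lie in `[0, V/x²]`, hence so does the modulus of their difference;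
the left tail serves for `x < 0`, the right one for `x > 0`. -/
theorem abs_cdf_sub_le_secondMoment {P Q : Measure ℝ} [IsProbabilityMeasure P]
    [IsProbabilityMeasure Q] {V : ℝ} (hV : 0 ≤ V) (hP : secondMoment P ≤ ENNReal.ofReal V)
    (hQ : secondMoment Q ≤ ENNReal.ofReal V) {x : ℝ} (hx : x ≠ 0) :
    |cdf P x - cdf Q x| ≤ V / x ^ 2 := by
  rcases lt_or_gt_of_ne hx with h | h
  · have hS : ∀ y ∈ Set.Iic x, x ^ 2 ≤ y ^ 2 := fun y hy => by
      have : y ≤ x := hy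
      nlinarith
    have h1 := measureReal_le_secondMoment_div hV hP hx hS
    have h2 := measureReal_le_secondMoment_div hV hQ hx hS
    rw [← cdf_eq_real] at h1 h2
    exact abs_le.2 ⟨by linarith [cdf_nonneg P x], by linarith [cdf_nonneg Q x]⟩
  · have hS : ∀ y ∈ (Set.Iic x)ᶜ, x ^ 2 ≤ y ^ 2 := fun y hy => by
      have : x < y := not_le.1 hy
      nlinarith
    have h1 := measureReal_le_secondMoment_div hV hP hx hS
    have h2 := measureReal_le_secondMoment_div hV hQ hx hS
    rw [probReal_compl_eq_one_sub measurableSet_Iic, ← cdf_eq_real] at h1 h2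
    exact abs_le.2 ⟨by linarith [cdf_le_one Q x], by linarith [cdf_le_one P x]⟩

/-- If two distribution functions with bounded second moments are close on a grid of mesh `ε`,
then the distributions are at Wasserstein distance of the order `ε log ε⁻¹`. -/
theorem wasserstein_one_le_of_grid {P Q : Measure ℝ} [IsProbabilityMeasure P]
    [IsProbabilityMeasure Q] {V c ε : ℝ} (hV : 0 ≤ V) (hc : 0 ≤ c) (hε : 0 < ε)
    (hε1 : ε ≤ Real.exp (-1)) (hP : secondMoment P ≤ ENNReal.ofReal V)
    (hQ : secondMoment Q ≤ ENNReal.ofReal V)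
    (h : ∀ k ≤ ⌈(ε ^ 2)⁻¹⌉₊, |cdf P (k * ε) - cdf Q (k * ε)| ≤ c * (ε / (1 + k * ε) + ε ^ 2))
    (h' : ∀ k ≤ ⌈(ε ^ 2)⁻¹⌉₊,
      |cdf P (-(k * ε)) - cdf Q (-(k * ε))| ≤ c * (ε / (1 + k * ε) + ε ^ 2)) :
    wasserstein 1 P Q ≤ ENNReal.ofReal (2 * (16 * c + 1 + V) * ε * Real.log ε⁻¹) := by
  refine (wasserstein_one_le_lintegral_cdf P Q).trans ?_
  have h1 := setLIntegral_Ioi_abs_sub_le (monotone_cdf P) (monotone_cdf Q) hV hc hε hε1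
    (fun x hx => abs_cdf_sub_le_secondMoment hV hP hQ hx.ne')
    (fun x => by linarith [cdf_le_one Q x, cdf_nonneg Q 0]) h
  -- The negative half-axis is reduced to the positive one by the reflection `x ↦ -F(-x)`, which
  -- preserves monotonicity.
  have h2 := setLIntegral_Ioi_abs_sub_le (u := fun x => -cdf P (-x)) (v := fun x => -cdf Q (-x))
    (fun x y hxy => neg_le_neg (monotone_cdf P (neg_le_neg hxy)))
    (fun x y hxy => neg_le_neg (monotone_cdf Q (neg_le_neg hxy))) hV hc hε hε1
    (fun x hx => by
      rw [neg_sub_neg, abs_sub_comm, ← neg_sq x]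
      exact abs_cdf_sub_le_secondMoment hV hP hQ (neg_ne_zero.2 hx.ne'))
    (fun x => by linarith [cdf_nonneg Q (-x), cdf_le_one Q (-0)])
    (fun k hk => by rw [neg_sub_neg, abs_sub_comm]; exact h' k hk)
  have h3 : ∫⁻ x in Set.Iic 0, ENNReal.ofReal |cdf P x - cdf Q x| =
      ∫⁻ x in Set.Ioi 0, ENNReal.ofReal |-cdf P (-x) - -cdf Q (-x)| := by
    have := (Measure.measurePreserving_neg (volume : Measure ℝ)).setLIntegral_comp_preimage_emb
      (MeasurableEquiv.neg ℝ).measurableEmbedding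
      (fun x => ENNReal.ofReal |cdf P x - cdf Q x|) (Set.Iic 0)
    rw [← this]
    simp only [Set.neg_preimage, Set.neg_Iic, neg_zero, neg_sub_neg]
    rw [Measure.restrict_congr_set Ioi_ae_eq_Ici]
    simp only [abs_sub_comm]
  rw [← setLIntegral_univ, ← Set.Iic_union_Ioi (a := (0 : ℝ))]
  refine (lintegral_union_le _ _ _).trans ?_
  rw [h3]
  refine (add_le_add h2 h1).trans (le_of_eq ?_)
  have hl : 0 ≤ Real.log ε⁻¹ :=
    Real.log_nonneg ((one_le_inv₀ hε).2 (hε1.trans (by simp)))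
  rw [← ENNReal.ofReal_add (by positivity) (by positivity)]
  congr 1
  ring

/-! ### Chernoff bounds for counts in a set -/

section

theorem lintegral_pi_prod_eq_pow {α : Type*} [MeasurableSpace α] (P : Measure α)
    [IsProbabilityMeasure P] {n : ℕ} {g : α → ℝ≥0∞} (hg : Measurable g) :
    ∫⁻ x : Fin n → α, ∏ i, g (x i) ∂Measure.pi (fun _ => P) = (∫⁻ y, g y ∂P) ^ n := by
  have hind : iIndepFun (fun i (x : Fin n → α) => g (x i)) (Measure.pi fun _ => P) :=
    iIndepFun_pi (X := fun _ => g) fun _ => hg.aemeasurable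
  rw [lintegral_prod_eq_prod_lintegral_of_indepFun Finset.univ _ hind fun i => by fun_prop]
  have h : ∀ i : Fin n, ∫⁻ x : Fin n → α, g (x i) ∂Measure.pi (fun _ => P) = ∫⁻ y, g y ∂P :=
    fun i => (measurePreserving_eval (fun _ : Fin n => P) i).lintegral_comp hg
  simp [h]

/-- Since `exp z ≤ 1 + z + z²` for `|z| ≤ 1`, the centred linear term integrates to zero and only
the variance remains. Keeping the variance, unlike in Hoeffding's bound, is what sharpens the tests
far from the origin. -/
theorem lintegral_exp_indicator_sub_le {α : Type*} [MeasurableSpace α] (P : Measure α)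
    [IsProbabilityMeasure P] {S : Set α} (hS : MeasurableSet S) {r : ℝ} (hr : |r| ≤ 1) :
    ∫⁻ y, ENNReal.ofReal (Real.exp (r * (S.indicator (fun _ => (1 : ℝ)) y - P.real S))) ∂P ≤
      ENNReal.ofReal (Real.exp (r ^ 2 * (P.real S * (1 - P.real S)))) := by
  set p := P.real S with hp
  have hp0 : 0 ≤ p := measureReal_nonneg
  have hp1 : p ≤ 1 := measureReal_le_one
  have hq : P.real Sᶜ = 1 - p := probReal_compl_eq_one_sub hS
  have hexp : ∀ z : ℝ, |z| ≤ 1 → Real.exp z ≤ 1 + z + z ^ 2 := fun z hz => by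
    linarith [(abs_le.1 (Real.abs_exp_sub_one_sub_id_le hz)).2]
  rw [← lintegral_add_compl _ hS]
  have h1 : ∫⁻ y in S, ENNReal.ofReal
      (Real.exp (r * (S.indicator (fun _ => (1 : ℝ)) y - p))) ∂P =
      ENNReal.ofReal (Real.exp (r * (1 - p)) * p) := by
    rw [setLIntegral_congr_fun (g := fun _ => ENNReal.ofReal (Real.exp (r * (1 - p)))) hS
      fun y hy => by rw [Set.indicator_of_mem hy], setLIntegral_const,
      ENNReal.ofReal_mul (Real.exp_pos _).le, hp, ofReal_measureReal]
  have h2 : ∫⁻ y in Sᶜ, ENNReal.ofReal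
      (Real.exp (r * (S.indicator (fun _ => (1 : ℝ)) y - p))) ∂P =
      ENNReal.ofReal (Real.exp (r * (0 - p)) * (1 - p)) := by
    rw [setLIntegral_congr_fun (g := fun _ => ENNReal.ofReal (Real.exp (r * (0 - p)))) hS.compl
      fun y hy => by rw [Set.indicator_of_notMem hy], setLIntegral_const,
      ENNReal.ofReal_mul (Real.exp_pos _).le, ← hq, ofReal_measureReal]
  have hq0 : 0 ≤ 1 - p := by linarith
  rw [h1, h2, ← ENNReal.ofReal_add (by positivity) (by positivity)]
  refine ENNReal.ofReal_le_ofReal ?_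
  have e1 := hexp (r * (1 - p)) (by
    rw [abs_mul, abs_of_nonneg hq0]
    nlinarith [abs_nonneg r])
  have e2 := hexp (r * (0 - p)) (by
    rw [abs_mul, zero_sub, abs_neg, abs_of_nonneg hp0]
    nlinarith [abs_nonneg r])
  have e3 := Real.add_one_le_exp (r ^ 2 * (p * (1 - p)))
  have e4 := mul_le_mul_of_nonneg_right e1 hp0
  have e5 := mul_le_mul_of_nonneg_right e2 hq0
  nlinarith

/-- Chernoff bound for the number of observations in `S` under a change of measure. -/
theorem setLIntegral_prod_le_exp {α : Type*} [MeasurableSpace α] {P₀ P : Measure α}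
    [IsProbabilityMeasure P₀] [IsProbabilityMeasure P] {ρ : α → ℝ≥0∞} (hρ : Measurable ρ)
    (hP : P₀.withDensity ρ ≤ P) {S : Set α} (hS : MeasurableSet S) {r t : ℝ} (hr : |r| ≤ 1)
    {n : ℕ} {G : Set (Fin n → α)} (hG : MeasurableSet G)
    (hGt : ∀ x ∈ G, n * t ≤ ∑ i, r * (S.indicator (fun _ => (1 : ℝ)) (x i) - P.real S)) :
    ∫⁻ x in G, ∏ i, ρ (x i) ∂Measure.pi (fun _ => P₀) ≤
      ENNReal.ofReal (Real.exp (n * (r ^ 2 * (P.real S * (1 - P.real S)) - t))) := by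
  set p := P.real S with hp
  set h : α → ℝ≥0∞ :=
    fun y => ENNReal.ofReal (Real.exp (r * (S.indicator (fun _ => (1 : ℝ)) y - p))) with hh
  have hhm : Measurable h := by
    have : Measurable (S.indicator fun _ => (1 : ℝ)) := measurable_const.indicator hS
    fun_prop
  calc ∫⁻ x in G, ∏ i, ρ (x i) ∂Measure.pi (fun _ => P₀)
      ≤ ∫⁻ x in G, ENNReal.ofReal (Real.exp (-(n * t))) * ∏ i, (ρ (x i) * h (x i))
          ∂Measure.pi (fun _ => P₀) := by
        refine setLIntegral_mono' hG fun x hx => ?_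
        -- Markov's inequality in exponential form: on `G` the tilting factor is at least one.
        have h1 : (1 : ℝ≥0∞) ≤ ENNReal.ofReal (Real.exp (-(n * t))) * ∏ i, h (x i) := by
          rw [hh, ← ENNReal.ofReal_prod_of_nonneg fun i _ => (Real.exp_pos _).le,
            ← Real.exp_sum, ← ENNReal.ofReal_mul (Real.exp_pos _).le, ← Real.exp_add,
            ENNReal.one_le_ofReal, Real.one_le_exp_iff]
          linarith [hGt x hx]
        rw [Finset.prod_mul_distrib, mul_left_comm]
        exact le_mul_of_one_le_right zero_le h1
    _ ≤ ∫⁻ x, ENNReal.ofReal (Real.exp (-(n * t))) * ∏ i, (ρ (x i) * h (x i))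
          ∂Measure.pi (fun _ => P₀) := setLIntegral_le_lintegral _ _
    _ = ENNReal.ofReal (Real.exp (-(n * t))) * (∫⁻ y, ρ y * h y ∂P₀) ^ n := by
        rw [lintegral_const_mul _ (by fun_prop),
          lintegral_pi_prod_eq_pow (g := fun y => ρ y * h y) P₀ (by fun_prop)]
    _ ≤ ENNReal.ofReal (Real.exp (-(n * t))) *
          (ENNReal.ofReal (Real.exp (r ^ 2 * (p * (1 - p))))) ^ n := by
        gcongr
        rw [← Pi.mul_def, ← lintegral_withDensity_eq_lintegral_mul _ hρ hhm]
        exact (lintegral_mono' hP le_rfl).trans (lintegral_exp_indicator_sub_le P hS hr)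
    _ = _ := by
        rw [← ENNReal.ofReal_pow (Real.exp_pos _).le, ← Real.exp_nat_mul,
          ← ENNReal.ofReal_mul (Real.exp_pos _).le, ← Real.exp_add]
        congr 2
        ring

/-- The natural choice is `r = ε/w`. It is admissible only if `ε ≤ w`; otherwise `r = 1`, and the
summand `ε²` of the threshold does the work. -/
theorem exists_chernoff_parameter {ε w V c v : ℝ} (hε : 0 < ε) (hw : 0 < w) (hc : 0 ≤ c)
    (hv : v ≤ V * w ^ 2) (hV : 0 ≤ V) :
    ∃ r : ℝ, 0 ≤ r ∧ r ≤ 1 ∧ r ^ 2 * v - r * (c * (ε * w + ε ^ 2)) ≤ -((c - V) * ε ^ 2) := by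
  rcases le_total ε w with h | h
  · refine ⟨ε / w, by positivity, (div_le_one hw).2 h, ?_⟩
    have h1 : (ε / w) ^ 2 * v ≤ V * ε ^ 2 := by
      calc (ε / w) ^ 2 * v ≤ (ε / w) ^ 2 * (V * w ^ 2) := by gcongr
        _ = V * ε ^ 2 := by field_simp
    have h2 : c * ε ^ 2 ≤ ε / w * (c * (ε * w + ε ^ 2)) := by
      calc c * ε ^ 2 = ε / w * (c * (ε * w)) := by field_simp
        _ ≤ ε / w * (c * (ε * w + ε ^ 2)) := by gcongr; nlinarith
    linarith
  · refine ⟨1, zero_le_one, le_rfl, ?_⟩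
    have h1 : V * w ^ 2 ≤ V * ε ^ 2 := by gcongr
    have h2 : 0 ≤ c * (ε * w) := by positivity
    linarith

variable {α : Type*} [MeasurableSpace α] {P₀ P : Measure α}
  [IsProbabilityMeasure P₀] [IsProbabilityMeasure P]

/-- The samples with fewer than `n (P₀ S + t)` observations in `S`. -/
def countBelow (P₀ : Measure α) (S : Set α) (t : ℝ) (n : ℕ) : Set (Fin n → α) :=
  {x | ∑ i, S.indicator (fun _ => (1 : ℝ)) (x i) < n * (P₀.real S + t)}

theorem mem_countBelow {P₀ : Measure α} {S : Set α} {t : ℝ} {n : ℕ} {x : Fin n → α} :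
    x ∈ countBelow P₀ S t n ↔
      ∑ i, S.indicator (fun _ => (1 : ℝ)) (x i) < n * (P₀.real S + t) := Iff.rfl

theorem measurableSet_countBelow (P₀ : Measure α) {S : Set α} (hS : MeasurableSet S) (t : ℝ)
    (n : ℕ) : MeasurableSet (countBelow P₀ S t n) := by
  have : Measurable (S.indicator fun _ => (1 : ℝ)) := measurable_const.indicator hS
  exact measurableSet_lt (by fun_prop) measurable_const

/-- Error of the first kind of the counting test: the Chernoff bound without change of measure. -/
theorem measure_compl_countBelow_le {S : Set α} (hS : MeasurableSet S) {ε w V c : ℝ}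
    (hε : 0 < ε) (hw : 0 < w) (hc : 0 ≤ c) (hV : 0 ≤ V)
    (hvar : P₀.real S * (1 - P₀.real S) ≤ V * w ^ 2) (n : ℕ) :
    Measure.pi (fun _ => P₀) (countBelow P₀ S (c * (ε * w + ε ^ 2)) n)ᶜ ≤
      ENNReal.ofReal (Real.exp (-(n * ((c - V) * ε ^ 2)))) := by
  obtain ⟨r, hr0, hr1, hr⟩ := exists_chernoff_parameter hε hw hc hvar hV
  have h := setLIntegral_prod_le_exp (P₀ := P₀) (P := P₀) (ρ := fun _ => 1) measurable_const
    (by simp) hS (r := r) (t := r * (c * (ε * w + ε ^ 2))) (by rwa [abs_of_nonneg hr0])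
    (measurableSet_countBelow P₀ hS (c * (ε * w + ε ^ 2)) n).compl (fun x hx => by
      have hx' := not_lt.1 (mt mem_countBelow.2 hx)
      rw [← Finset.mul_sum, Finset.sum_sub_distrib]
      simp only [Finset.sum_const, Finset.card_univ, Fintype.card_fin, nsmul_eq_mul]
      nlinarith)
  simp only [Finset.prod_const_one, setLIntegral_one] at h
  refine h.trans (ENNReal.ofReal_le_ofReal (Real.exp_le_exp.2 ?_))
  rw [← mul_neg]
  gcongr

/-- Error of the second kind: the threshold lies halfway to the separation `2t`, so under `P` the
count must fall short of its mean by `nt`; hence the negative tilt `-r`. -/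
theorem setLIntegral_countBelow_le {ρ : α → ℝ≥0∞} (hρ : Measurable ρ)
    (hP : P₀.withDensity ρ ≤ P) {S : Set α} (hS : MeasurableSet S) {ε w V c : ℝ}
    (hε : 0 < ε) (hw : 0 < w) (hc : 0 ≤ c) (hV : 0 ≤ V)
    (hvar : P.real S * (1 - P.real S) ≤ V * w ^ 2)
    (hsep : P₀.real S + 2 * (c * (ε * w + ε ^ 2)) ≤ P.real S) (n : ℕ) :
    ∫⁻ x in countBelow P₀ S (c * (ε * w + ε ^ 2)) n, ∏ i, ρ (x i) ∂Measure.pi (fun _ => P₀) ≤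
      ENNReal.ofReal (Real.exp (-(n * ((c - V) * ε ^ 2)))) := by
  obtain ⟨r, hr0, hr1, hr⟩ := exists_chernoff_parameter hε hw hc hvar hV
  have h := setLIntegral_prod_le_exp (P₀ := P₀) (P := P) hρ hP hS (r := -r)
    (t := r * (c * (ε * w + ε ^ 2))) (by rwa [abs_neg, abs_of_nonneg hr0])
    (measurableSet_countBelow P₀ hS (c * (ε * w + ε ^ 2)) n) (fun x hx => by
      have hx' := (mem_countBelow.1 hx).le
      rw [← Finset.mul_sum, Finset.sum_sub_distrib]
      simp only [Finset.sum_const, Finset.card_univ, Fintype.card_fin, nsmul_eq_mul]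
      have hn : (0 : ℝ) ≤ n := n.cast_nonneg
      have h1 := mul_le_mul_of_nonneg_left hsep hn
      have h2 : n * (c * (ε * w + ε ^ 2)) ≤ n * P.real S -
          ∑ i, S.indicator (fun _ => (1 : ℝ)) (x i) := by linarith
      nlinarith)
  refine h.trans (ENNReal.ofReal_le_ofReal (Real.exp_le_exp.2 ?_))
  rw [← mul_neg, neg_sq]
  gcongr

/-- Only an inequality: the mass of `P` on `{f₀ = 0}` is lost, as division by zero gives zero. -/
theorem withDensity_div_le {P₀ P : Measure ℝ} {f₀ g : ℝ → ℝ} (hf₀ : IsDensity f₀ P₀)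
    (hg : IsDensity g P) :
    P₀.withDensity (fun x => ENNReal.ofReal (g x / f₀ x)) ≤ P := by
  have h1 := hf₀.measurable
  have h2 := hg.measurable
  rw [hf₀.eq_withDensity, hg.eq_withDensity, ← withDensity_mul _ (by fun_prop) (by fun_prop)]
  refine withDensity_mono (ae_of_all _ fun x => ?_)
  rw [Pi.mul_apply, ← ENNReal.ofReal_mul (hf₀.nonneg x)]
  refine ENNReal.ofReal_le_ofReal ?_
  rcases eq_or_ne (f₀ x) 0 with h | h
  · simpa [h] using hg.nonneg x
  · rw [mul_div_cancel₀ _ h]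

end

/-! ### Kullback-Leibler neighbourhoods and the posterior denominator -/

section

theorem IsDensity.ae_pos {f₀ : ℝ → ℝ} {P₀ : Measure ℝ} (hf₀ : IsDensity f₀ P₀) :
    ∀ᵐ x ∂P₀, 0 < f₀ x := by
  have := hf₀.measurable
  rw [hf₀.eq_withDensity, ae_withDensity_iff (by fun_prop)]
  refine ae_of_all _ fun x hx => ?_
  simpa using hx

/-- The integrand is infinite where `g` vanishes and `f₀` does not, so that set must be null. -/
theorem ae_pos_of_klSecondMoment_ne_top {P₀ P : Measure ℝ} {f₀ g : ℝ → ℝ}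
    (hf₀ : IsDensity f₀ P₀) (hg : IsDensity g P) (h : klSecondMoment P₀ f₀ g ≠ ∞) :
    ∀ᵐ x ∂P₀, 0 < g x := by
  have h1 := hf₀.measurable
  have h2 := hg.measurable
  have hZ : MeasurableSet {x | g x = 0 ∧ 0 < f₀ x} :=
    (measurableSet_eq_fun h2 measurable_const).inter (measurableSet_lt measurable_const h1)
  have h3 : ∞ * P₀ {x | g x = 0 ∧ 0 < f₀ x} ≤ klSecondMoment P₀ f₀ g := by
    rw [← setLIntegral_const]
    refine le_trans (setLIntegral_mono' hZ fun x hx => ?_) (setLIntegral_le_lintegral _ _)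
    have hx2 : ENNReal.ofReal (f₀ x) ≠ 0 := by simpa using hx.2
    rw [hx.1, ENNReal.ofReal_zero, ENNReal.div_zero hx2]
    simp
  have h4 : P₀ {x | g x = 0 ∧ 0 < f₀ x} = 0 := by
    by_contra h5
    rw [ENNReal.top_mul h5, top_le_iff] at h3
    exact h h3
  filter_upwards [hf₀.ae_pos, measure_eq_zero_iff_ae_notMem.1 h4] with x hx hx'
  exact (hg.nonneg x).lt_of_ne fun h0 => hx' ⟨h0.symm, hx⟩

theorem lintegral_log_sq_eq_klSecondMoment {P₀ : Measure ℝ} {f₀ g : ℝ → ℝ}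
    (hf₀ : IsDensity f₀ P₀) (hg : ∀ᵐ x ∂P₀, 0 < g x) :
    ∫⁻ x, ENNReal.ofReal (Real.log (f₀ x / g x) ^ 2) ∂P₀ = klSecondMoment P₀ f₀ g := by
  refine lintegral_congr_ae ?_
  filter_upwards [hf₀.ae_pos, hg] with x h1 h2
  rw [← ENNReal.ofReal_div_of_pos h2, ENNReal.log_ofReal_of_pos (by positivity), EReal.abs_def,
    ← ENNReal.ofReal_pow (abs_nonneg _), sq_abs]

theorem eq_withDensity_div {P₀ P : Measure ℝ} {f₀ g : ℝ → ℝ}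
    (hf₀ : IsDensity f₀ P₀) (hg : IsDensity g P) (hpos : ∀ᵐ x ∂P₀, 0 < g x) :
    P₀ = P.withDensity fun x => ENNReal.ofReal (f₀ x / g x) := by
  have h1 := hf₀.measurable
  have h2 := hg.measurable
  rw [hf₀.eq_withDensity, ae_withDensity_iff (by fun_prop)] at hpos
  conv_lhs => rw [hf₀.eq_withDensity]
  rw [hg.eq_withDensity, ← withDensity_mul _ (by fun_prop) (by fun_prop)]
  refine withDensity_congr_ae ?_
  filter_upwards [hpos] with x hx
  rw [Pi.mul_apply, ← ENNReal.ofReal_mul (hg.nonneg x)]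
  rcases eq_or_ne (ENNReal.ofReal (f₀ x)) 0 with h | h
  · have : f₀ x = 0 := le_antisymm (by simpa using h) (hf₀.nonneg x)
    simp [this]
  · rw [mul_div_cancel₀ _ (hx h).ne']

theorem llr_ae_eq_log_div {P₀ P : Measure ℝ} [IsProbabilityMeasure P] {f₀ g : ℝ → ℝ}
    (hf₀ : IsDensity f₀ P₀) (hg : IsDensity g P) (hpos : ∀ᵐ x ∂P₀, 0 < g x) :
    llr P₀ P =ᵐ[P₀] fun x => Real.log (f₀ x / g x) := by
  have h1 := hf₀.measurable
  have h2 := hg.measurable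
  have heq := eq_withDensity_div hf₀ hg hpos
  have hac : P₀ ≪ P := by rw [heq]; exact withDensity_absolutelyContinuous _ _
  have h3 : P₀.rnDeriv P =ᵐ[P] fun x => ENNReal.ofReal (f₀ x / g x) := by
    conv_lhs => rw [heq]
    exact Measure.rnDeriv_withDensity P (by fun_prop)
  filter_upwards [hac.ae_le h3] with x hx
  rw [llr, hx, ENNReal.toReal_ofReal (div_nonneg (hf₀.nonneg x) (hg.nonneg x))]

variable {F : Set (ProbabilityMeasure ℝ)}

/-- The Kullback-Leibler type neighbourhood, in terms of the real-valued log-likelihood ratio. -/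
def logRatioNeighbourhood (f : F → ℝ → ℝ) (P₀ : Measure ℝ) (f₀ : ℝ → ℝ) (ε : ℝ) : Set F :=
  {P | (∀ᵐ x ∂P₀, 0 < f P x) ∧
    ∫⁻ x, ENNReal.ofReal (Real.log (f₀ x / f P x) ^ 2) ∂P₀ ≤ ENNReal.ofReal (ε ^ 2) ∧
    ∫ x, Real.log (f₀ x / f P x) ∂P₀ ≤ ε ^ 2}

/-- Passing to a larger set keeps the lower bound on the prior mass and gains measurability, through
measurability of parametric integrals. -/
theorem klNeighbourhood_subset {f : F → ℝ → ℝ} (hf : IsDensityFamily f) {P₀ : Measure ℝ}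
    [IsProbabilityMeasure P₀] {f₀ : ℝ → ℝ} (hf₀ : IsDensity f₀ P₀) (ε : ℝ) :
    klNeighbourhood f P₀ f₀ ε ⊆ logRatioNeighbourhood f P₀ f₀ ε := by
  rintro P ⟨h1, h2⟩
  have hpos := ae_pos_of_klSecondMoment_ne_top hf₀ (hf.isDensity P)
    (ne_top_of_le_ne_top ENNReal.ofReal_ne_top h2)
  refine ⟨hpos, (lintegral_log_sq_eq_klSecondMoment hf₀ hpos).trans_le h2, ?_⟩
  obtain ⟨hac, hint⟩ :=
    InformationTheory.klDiv_ne_top_iff.1 (ne_top_of_le_ne_top ENNReal.ofReal_ne_top h1)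
  rw [InformationTheory.klDiv_of_ac_of_integrable hac hint,
    integral_congr_ae (llr_ae_eq_log_div hf₀ (hf.isDensity P) hpos)] at h1
  have h3 := (ENNReal.ofReal_le_ofReal_iff (sq_nonneg ε)).1 h1
  simpa using h3

theorem measurableSet_logRatioNeighbourhood {f : F → ℝ → ℝ} (hf : IsDensityFamily f)
    {P₀ : Measure ℝ} [IsProbabilityMeasure P₀] {f₀ : ℝ → ℝ} (hf₀ : IsDensity f₀ P₀) (ε : ℝ) :
    MeasurableSet (logRatioNeighbourhood f P₀ f₀ ε) := by
  have h1 : Measurable fun z : F × ℝ => f z.1 z.2 := hf.measurable_uncurry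
  have h2 := hf₀.measurable
  have hlog : Measurable fun z : F × ℝ => Real.log (f₀ z.2 / f z.1 z.2) := by fun_prop
  refine MeasurableSet.inter ?_ (MeasurableSet.inter ?_ ?_)
  · have hs : MeasurableSet {z : F × ℝ | ¬ 0 < f z.1 z.2} :=
      (measurableSet_lt measurable_const h1).compl
    exact (measurable_measure_prodMk_left hs) (measurableSet_singleton 0)
  · exact measurableSet_le
      (Measurable.lintegral_prod_right
        (f := fun P x => ENNReal.ofReal (Real.log (f₀ x / f P x) ^ 2))
        (hlog.pow_const 2).ennreal_ofReal) measurable_const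
  · exact measurableSet_le
      (StronglyMeasurable.integral_prod_right
        (f := fun P x => Real.log (f₀ x / f P x)) hlog.stronglyMeasurable).measurable
      measurable_const

theorem measurable_likelihoodRatio {f : F → ℝ → ℝ} (hf : IsDensityFamily f) {f₀ : ℝ → ℝ}
    (hf₀ : Measurable f₀) (n : ℕ) :
    Measurable fun z : F × (Fin n → ℝ) => likelihoodRatio f f₀ z.2 z.1 := by
  have h1 : ∀ i, Measurable fun z : F × (Fin n → ℝ) => f z.1 (z.2 i) := fun i =>
    hf.measurable_uncurry.comp
      (measurable_fst.prodMk ((measurable_pi_apply i).comp measurable_snd))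
  have h2 : ∀ i, Measurable fun z : F × (Fin n → ℝ) => f₀ (z.2 i) := fun i =>
    hf₀.comp ((measurable_pi_apply i).comp measurable_snd)
  exact (Finset.measurable_fun_prod _ fun i _ => (h1 i).div (h2 i)).ennreal_ofReal

/-- Minus the log-likelihood ratio is a sum of `n` independent terms of mean and variance at most
`ε²`. The event forces a deviation of at least `nε²` from the mean, and Chebyshev applies. -/
theorem measure_likelihoodRatio_lt_le {f : F → ℝ → ℝ} (hf : IsDensityFamily f) {P₀ : Measure ℝ}
    [IsProbabilityMeasure P₀] {f₀ : ℝ → ℝ} (hf₀ : IsDensity f₀ P₀) {ε : ℝ} (hε : 0 < ε) {n : ℕ}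
    (hn : 0 < n) {P : F} (hP : P ∈ logRatioNeighbourhood f P₀ f₀ ε) :
    Measure.pi (fun _ : Fin n => P₀)
      {x | likelihoodRatio f f₀ x P < ENNReal.ofReal (Real.exp (-(2 * (n * ε ^ 2))))} ≤
      ENNReal.ofReal (n * ε ^ 2)⁻¹ := by
  obtain ⟨hpos, hsq, hmean⟩ := hP
  have hn' : (0 : ℝ) < n := by exact_mod_cast hn
  set h : ℝ → ℝ := fun x => Real.log (f₀ x / f P x) with hh
  have hhm : Measurable h := by
    have := hf₀.measurable
    have := (hf.isDensity P).measurable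
    fun_prop
  have hint : Integrable (fun x => h x ^ 2) P₀ := by
    refine ⟨(hhm.pow_const 2).aestronglyMeasurable, ?_⟩
    rw [hasFiniteIntegral_iff_ofReal (ae_of_all _ fun x => sq_nonneg _)]
    exact hsq.trans_lt ENNReal.ofReal_lt_top
  have hL2 : MemLp h 2 P₀ := (memLp_two_iff_integrable_sq hhm.aestronglyMeasurable).2 hint
  have hvar : Var[h; P₀] ≤ ε ^ 2 := by
    refine (variance_le_expectation_sq hhm.aestronglyMeasurable).trans ?_
    rw [← ofReal_integral_eq_lintegral_ofReal hint (ae_of_all _ fun x => sq_nonneg _)] at hsq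
    exact (ENNReal.ofReal_le_ofReal_iff (sq_nonneg ε)).1 hsq
  set Q := Measure.pi (fun _ : Fin n => P₀) with hQ
  set Y : (Fin n → ℝ) → ℝ := ∑ i, fun x => h (x i) with hY
  have hmp : ∀ i : Fin n, MeasurePreserving (Function.eval i) Q P₀ :=
    measurePreserving_eval fun _ : Fin n => P₀
  have hLi : ∀ i : Fin n, MemLp (fun x : Fin n → ℝ => h (x i)) 2 Q := fun i =>
    hL2.comp_measurePreserving (hmp i)
  have hYL : MemLp Y 2 Q := memLp_finsetSum' _ fun i _ => hLi i
  have hYvar : Var[Y; Q] ≤ n * ε ^ 2 := by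
    rw [hY, hQ, variance_sum_pi (X := fun _ => h) fun _ => hL2]
    simp only [Finset.sum_const, Finset.card_univ, Fintype.card_fin, nsmul_eq_mul]
    gcongr
  have hYmean : ∫ x, Y x ∂Q ≤ n * ε ^ 2 := by
    simp only [hY, Finset.sum_apply]
    rw [integral_finsetSum _ fun i _ => (hLi i).integrable (by norm_num)]
    have h1 : ∀ i : Fin n, ∫ x, h (x i) ∂Q = ∫ y, h y ∂P₀ := fun i =>
      integral_comp_eval hhm.aestronglyMeasurable
    simp only [h1, Finset.sum_const, Finset.card_univ, Fintype.card_fin, nsmul_eq_mul]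
    gcongr
  have hpos' : ∀ᵐ x ∂Q, ∀ i, 0 < f P (x i) ∧ 0 < f₀ (x i) :=
    ae_all_iff.2 fun i => (hmp i).quasiMeasurePreserving.ae (hpos.and hf₀.ae_pos)
  have ht : 0 < n * ε ^ 2 := by positivity
  calc Q {x | likelihoodRatio f f₀ x P < ENNReal.ofReal (Real.exp (-(2 * (n * ε ^ 2))))}
      ≤ Q {x | n * ε ^ 2 ≤ |Y x - ∫ z, Y z ∂Q|} := by
        refine measure_mono_ae ?_
        filter_upwards [hpos'] with x hx hlt
        have hlt' : likelihoodRatio f f₀ x P <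
          ENNReal.ofReal (Real.exp (-(2 * (n * ε ^ 2)))) := hlt
        have hprod : ∏ i, f P (x i) / f₀ (x i) = Real.exp (-Y x) := by
          rw [hY, Finset.sum_apply, ← Finset.sum_neg_distrib, Real.exp_sum]
          refine Finset.prod_congr rfl fun i _ => ?_
          rw [hh, ← Real.log_inv, inv_div, Real.exp_log (div_pos (hx i).1 (hx i).2)]
        rw [likelihoodRatio, hprod, ENNReal.ofReal_lt_ofReal_iff (Real.exp_pos _),
          Real.exp_lt_exp] at hlt'
        show n * ε ^ 2 ≤ |Y x - ∫ z, Y z ∂Q|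
        exact le_trans (by linarith) (le_abs_self _)
    _ ≤ ENNReal.ofReal (Var[Y; Q] / (n * ε ^ 2) ^ 2) := meas_ge_le_variance_div_sq hYL ht
    _ ≤ ENNReal.ofReal (n * ε ^ 2)⁻¹ := by
        refine ENNReal.ofReal_le_ofReal ?_
        rw [div_le_iff₀ (by positivity)]
        refine hYvar.trans (le_of_eq ?_)
        field_simp

/-- Lower bound for the denominator of the posterior. -/
theorem measure_lintegral_likelihoodRatio_lt_le {f : F → ℝ → ℝ} (hf : IsDensityFamily f)
    {P₀ : Measure ℝ} [IsProbabilityMeasure P₀] {f₀ : ℝ → ℝ} (hf₀ : IsDensity f₀ P₀)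
    (prior : Measure F) [IsProbabilityMeasure prior] {ε : ℝ} (hε : 0 < ε) {n : ℕ} (hn : 0 < n)
    (hKL : ENNReal.ofReal (Real.exp (-(n * ε ^ 2))) ≤ prior (klNeighbourhood f P₀ f₀ ε)) :
    Measure.pi (fun _ : Fin n => P₀)
      {x | ∫⁻ P, likelihoodRatio f f₀ x P ∂prior <
        ENNReal.ofReal (Real.exp (-(3 * (n * ε ^ 2))) / 2)} ≤
      ENNReal.ofReal (2 * (n * ε ^ 2)⁻¹) := by
  set Q := Measure.pi (fun _ : Fin n => P₀) with hQ
  set A := logRatioNeighbourhood f P₀ f₀ ε with hA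
  have hAm : MeasurableSet A := measurableSet_logRatioNeighbourhood hf hf₀ ε
  have hAp : ENNReal.ofReal (Real.exp (-(n * ε ^ 2))) ≤ prior A :=
    hKL.trans (measure_mono (klNeighbourhood_subset hf hf₀ ε))
  have hA0 : prior A ≠ 0 := (lt_of_lt_of_le (by simp [Real.exp_pos]) hAp).ne'
  have hAt : prior A ≠ ∞ := measure_ne_top _ _
  set e := ENNReal.ofReal (Real.exp (-(2 * (n * ε ^ 2)))) with he
  set B : Set (F × (Fin n → ℝ)) := {z | likelihoodRatio f f₀ z.2 z.1 < e} with hB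
  have hBm : MeasurableSet B :=
    measurableSet_lt (measurable_likelihoodRatio hf hf₀.measurable n) measurable_const
  -- The prior mass, within `A`, of the `P` whose likelihood ratio at `x` is small. Its mean is
  -- controlled by Fubini, and Markov then shows that it rarely reaches half of `prior A`.
  set g : (Fin n → ℝ) → ℝ≥0∞ := fun x => prior.restrict A ((fun P => (P, x)) ⁻¹' B) with hg
  have hgm : Measurable g := measurable_measure_prodMk_right hBm
  have hgint : ∫⁻ x, g x ∂Q ≤ prior A * ENNReal.ofReal (n * ε ^ 2)⁻¹ := by
    rw [hg, ← Measure.prod_apply_symm hBm, Measure.prod_apply hBm, mul_comm, ← setLIntegral_const]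
    exact setLIntegral_mono' hAm fun P hP => measure_likelihoodRatio_lt_le hf hf₀ hε hn hP
  calc Q {x | ∫⁻ P, likelihoodRatio f f₀ x P ∂prior <
        ENNReal.ofReal (Real.exp (-(3 * (n * ε ^ 2))) / 2)}
      ≤ Q {x | prior A / 2 ≤ g x} := by
        refine measure_mono fun x hx => ?_
        have hx' : ∫⁻ P, likelihoodRatio f f₀ x P ∂prior <
          ENNReal.ofReal (Real.exp (-(3 * (n * ε ^ 2))) / 2) := hx
        by_contra hlt
        have hlt' : g x < prior A / 2 := not_le.1 hlt
        have hxm : MeasurableSet ((fun P => (P, x)) ⁻¹' B) := measurable_prodMk_right hBm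
        have hsum : g x + prior (A \ (fun P => (P, x)) ⁻¹' B) = prior A := by
          rw [hg]
          dsimp only
          rw [Measure.restrict_apply hxm, Set.inter_comm]
          exact measure_inter_add_sdiff A hxm
        have hhalf : prior A / 2 ≤ prior (A \ (fun P => (P, x)) ⁻¹' B) := by
          by_contra hc
          have := ENNReal.add_lt_add hlt' (not_le.1 hc)
          rw [hsum, ENNReal.add_halves] at this
          exact lt_irrefl _ this
        refine absurd hx' (not_lt.2 ?_)
        -- The exponent is `3 = 2 + 1`: likelihood ratio at least `exp(-2nε²)` on a set of prior
        -- mass at least `exp(-nε²)/2`.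
        calc ENNReal.ofReal (Real.exp (-(3 * (n * ε ^ 2))) / 2)
            = e * (ENNReal.ofReal (Real.exp (-(n * ε ^ 2))) / 2) := by
              rw [he, ENNReal.ofReal_div_of_pos two_pos, ← mul_div_assoc,
                ← ENNReal.ofReal_mul (Real.exp_pos _).le, ← Real.exp_add]
              congr 3
              · ring
              · simp
          _ ≤ e * prior (A \ (fun P => (P, x)) ⁻¹' B) := by
              gcongr
              exact (ENNReal.div_le_div_right hAp 2).trans hhalf
          _ = ∫⁻ _ in A \ (fun P => (P, x)) ⁻¹' B, e ∂prior := (setLIntegral_const _ _).symm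
          _ ≤ ∫⁻ P in A \ (fun P => (P, x)) ⁻¹' B, likelihoodRatio f f₀ x P ∂prior :=
              setLIntegral_mono' (hAm.diff hxm) fun P hP => not_lt.1 hP.2
          _ ≤ ∫⁻ P, likelihoodRatio f f₀ x P ∂prior := setLIntegral_le_lintegral _ _
    _ ≤ (∫⁻ x, g x ∂Q) / (prior A / 2) :=
        meas_ge_le_lintegral_div hgm.aemeasurable (by simp [hA0])
          (ENNReal.div_ne_top hAt two_ne_zero)
    _ ≤ prior A * ENNReal.ofReal (n * ε ^ 2)⁻¹ / (prior A / 2) := by gcongr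
    _ = ENNReal.ofReal (2 * (n * ε ^ 2)⁻¹) := by
        rw [div_eq_mul_inv, ENNReal.inv_div (Or.inl ENNReal.ofNat_ne_top) (Or.inl two_ne_zero),
          div_eq_mul_inv, ENNReal.ofReal_mul zero_le_two, ENNReal.ofReal_ofNat]
        calc prior A * ENNReal.ofReal (n * ε ^ 2)⁻¹ * (2 * (prior A)⁻¹)
            = prior A * (prior A)⁻¹ * (2 * ENNReal.ofReal (n * ε ^ 2)⁻¹) := by ring
          _ = 2 * ENNReal.ofReal (n * ε ^ 2)⁻¹ := by rw [ENNReal.mul_inv_cancel hA0 hAt, one_mul]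

/-! ### Posterior numerators on sets of excess mass -/

theorem measurable_coe_measure :
    Measurable fun P : F => ((P : ProbabilityMeasure ℝ) : Measure ℝ) :=
  measurable_subtype_coe.comp measurable_subtype_coe

theorem measurable_real_apply {S : Set ℝ} (hS : MeasurableSet S) :
    Measurable fun P : F => ((P : ProbabilityMeasure ℝ) : Measure ℝ).real S :=
  ((Measure.measurable_coe hS).comp measurable_coe_measure).ennreal_toReal

/-- The members of the family that give `S` at least the mass `P₀ S + 2 t`, where the variance of
the indicator of `S` is at most `v`. -/
def excessMass (F : Set (ProbabilityMeasure ℝ)) (P₀ : Measure ℝ) (S : Set ℝ) (v t : ℝ) : Set F :=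
  {P | ((P : ProbabilityMeasure ℝ) : Measure ℝ).real S *
      (1 - ((P : ProbabilityMeasure ℝ) : Measure ℝ).real S) ≤ v ∧
    P₀.real S + 2 * t ≤ ((P : ProbabilityMeasure ℝ) : Measure ℝ).real S}

theorem measurableSet_excessMass (P₀ : Measure ℝ) {S : Set ℝ} (hS : MeasurableSet S) (v t : ℝ) :
    MeasurableSet (excessMass F P₀ S v t) := by
  have := measurable_real_apply (F := F) hS
  exact (measurableSet_le (this.mul (measurable_const.sub this)) measurable_const).inter
    (measurableSet_le measurable_const this)

/-- Fubini turns the mean numerator into a prior average of errors of the second kind. -/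
theorem setLIntegral_countBelow_excessMass_le {f : F → ℝ → ℝ} (hf : IsDensityFamily f)
    {P₀ : Measure ℝ} [IsProbabilityMeasure P₀] {f₀ : ℝ → ℝ} (hf₀ : IsDensity f₀ P₀)
    (prior : Measure F) [IsProbabilityMeasure prior] {S : Set ℝ} (hS : MeasurableSet S)
    {ε w V c : ℝ} (hε : 0 < ε) (hw : 0 < w) (hc : 0 ≤ c) (hV : 0 ≤ V) (n : ℕ) :
    ∫⁻ x in countBelow P₀ S (c * (ε * w + ε ^ 2)) n,
        ∫⁻ P in excessMass F P₀ S (V * w ^ 2) (c * (ε * w + ε ^ 2)),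
          likelihoodRatio f f₀ x P ∂prior ∂Measure.pi (fun _ => P₀) ≤
      ENNReal.ofReal (Real.exp (-(n * ((c - V) * ε ^ 2)))) := by
  rw [lintegral_lintegral_swap (f := fun x P => likelihoodRatio f f₀ x P)
    ((measurable_likelihoodRatio hf hf₀.measurable n).comp measurable_swap).aemeasurable]
  refine (setLIntegral_mono' (g := fun _ => ENNReal.ofReal (Real.exp (-(n * ((c - V) * ε ^ 2)))))
    (measurableSet_excessMass P₀ hS _ _) fun P hP => ?_).trans ?_
  · have hg := hf.isDensity P
    have h := setLIntegral_countBelow_le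
      (hg.measurable.div hf₀.measurable).ennreal_ofReal (withDensity_div_le hf₀ hg) hS hε hw hc hV
      hP.1 hP.2 n
    refine le_trans (le_of_eq ?_) h
    refine lintegral_congr fun x => ?_
    rw [likelihoodRatio, ENNReal.ofReal_prod_of_nonneg]
    · rfl
    · exact fun i _ => div_nonneg (hg.nonneg _) (hf₀.nonneg _)
  · rw [setLIntegral_const]
    exact mul_le_of_le_one_right zero_le prob_le_one

/-- The event lies in the union of three: a small denominator, a rejecting test under `P₀`, and a
large total numerator `H` while no test rejects. The last is handled by Markov. `A` enters only
through its cover, so it need not be measurable. -/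
theorem measure_mul_lintegral_le_setLIntegral_le {f : F → ℝ → ℝ} (hf : IsDensityFamily f)
    {P₀ : Measure ℝ} [IsProbabilityMeasure P₀] {f₀ : ℝ → ℝ} (hf₀ : IsDensity f₀ P₀)
    (prior : Measure F) [IsProbabilityMeasure prior] {ε : ℝ} (hε : 0 < ε) {n : ℕ} (hn : 0 < n)
    (hKL : ENNReal.ofReal (Real.exp (-(n * ε ^ 2))) ≤ prior (klNeighbourhood f P₀ f₀ ε))
    {ι : Type*} [Fintype ι] {S : ι → Set ℝ} (hS : ∀ i, MeasurableSet (S i)) {w : ι → ℝ}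
    (hw : ∀ i, 0 < w i) {V c : ℝ} (hc : 0 ≤ c) (hV : 0 ≤ V)
    (hvar : ∀ i, P₀.real (S i) * (1 - P₀.real (S i)) ≤ V * w i ^ 2) {A : Set F}
    (hA : A ⊆ ⋃ i, excessMass F P₀ (S i) (V * w i ^ 2) (c * (ε * w i + ε ^ 2)))
    {η : ℝ} (hη : 0 < η) :
    Measure.pi (fun _ : Fin n => P₀)
      {x | ENNReal.ofReal η * ∫⁻ P, likelihoodRatio f f₀ x P ∂prior ≤
        ∫⁻ P in A, likelihoodRatio f f₀ x P ∂prior} ≤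
      ENNReal.ofReal (2 * (n * ε ^ 2)⁻¹ +
        Fintype.card ι * Real.exp (-(n * ((c - V) * ε ^ 2))) +
        Fintype.card ι * Real.exp (-(n * ((c - V) * ε ^ 2))) /
          (η * (Real.exp (-(3 * (n * ε ^ 2))) / 2))) := by
  set Q := Measure.pi (fun _ : Fin n => P₀) with hQ
  set D : (Fin n → ℝ) → ℝ≥0∞ := fun x => ∫⁻ P, likelihoodRatio f f₀ x P ∂prior with hD
  set d := Real.exp (-(3 * (n * ε ^ 2))) / 2 with hd
  have hd0 : 0 < d := by positivity
  set E := Real.exp (-(n * ((c - V) * ε ^ 2))) with hE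
  have hE0 : 0 < E := Real.exp_pos _
  set G : ι → Set (Fin n → ℝ) := fun i => countBelow P₀ (S i) (c * (ε * w i + ε ^ 2)) n with hG
  have hGm : ∀ i, MeasurableSet (G i) := fun i => measurableSet_countBelow P₀ (hS i) _ n
  set N : ι → (Fin n → ℝ) → ℝ≥0∞ := fun i x =>
    ∫⁻ P in excessMass F P₀ (S i) (V * w i ^ 2) (c * (ε * w i + ε ^ 2)),
      likelihoodRatio f f₀ x P ∂prior with hN
  have hNm : ∀ i, Measurable (N i) := fun i =>
    Measurable.lintegral_prod_right (f := fun x P => likelihoodRatio f f₀ x P)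
      ((measurable_likelihoodRatio hf hf₀.measurable n).comp measurable_swap)
  set H : (Fin n → ℝ) → ℝ≥0∞ := fun x => ∑ i, (G i).indicator (N i) x with hH
  have hHm : Measurable H := Finset.measurable_fun_sum _ fun i _ => (hNm i).indicator (hGm i)
  have hHint : ∫⁻ x, H x ∂Q ≤ ENNReal.ofReal (Fintype.card ι * E) := by
    rw [hH, lintegral_finsetSum _ fun i _ => (hNm i).indicator (hGm i)]
    refine (Finset.sum_le_sum (g := fun _ => ENNReal.ofReal E) fun i _ => ?_).trans (le_of_eq ?_)
    · rw [lintegral_indicator (hGm i)]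
      exact setLIntegral_countBelow_excessMass_le hf hf₀ prior (hS i) hε (hw i) hc hV n
    · rw [Finset.sum_const, Finset.card_univ, nsmul_eq_mul, ENNReal.ofReal_mul (by positivity),
        ENNReal.ofReal_natCast]
  have hsub : {x | ENNReal.ofReal η * D x ≤ ∫⁻ P in A, likelihoodRatio f f₀ x P ∂prior} ⊆
      ({x | D x < ENNReal.ofReal d} ∪ ⋃ i, (G i)ᶜ) ∪ {x | ENNReal.ofReal (η * d) ≤ H x} := by
    intro x hx
    have hx' : ENNReal.ofReal η * D x ≤ ∫⁻ P in A, likelihoodRatio f f₀ x P ∂prior := hx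
    by_cases h1 : x ∈ {x | D x < ENNReal.ofReal d} ∪ ⋃ i, (G i)ᶜ
    · exact Or.inl h1
    · refine Or.inr ?_
      simp only [Set.mem_union, Set.mem_iUnion, not_or, not_exists] at h1
      have h2 : ENNReal.ofReal d ≤ D x := not_lt.1 h1.1
      have h3 : ∀ i, x ∈ G i := fun i => by simpa using h1.2 i
      show ENNReal.ofReal (η * d) ≤ H x
      calc ENNReal.ofReal (η * d) = ENNReal.ofReal η * ENNReal.ofReal d :=
            ENNReal.ofReal_mul hη.le
        _ ≤ ENNReal.ofReal η * D x := by gcongr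
        _ ≤ _ := hx'
        _ ≤ ∫⁻ P in ⋃ i, excessMass F P₀ (S i) (V * w i ^ 2) (c * (ε * w i + ε ^ 2)),
              likelihoodRatio f f₀ x P ∂prior := lintegral_mono_set hA
        _ ≤ ∑' i, N i x := lintegral_iUnion_le _ _
        _ = H x := by
            rw [tsum_fintype, hH]
            exact Finset.sum_congr rfl fun i _ => (Set.indicator_of_mem (h3 i) (N i)).symm
  have hb1 : Q {x | D x < ENNReal.ofReal d} ≤ ENNReal.ofReal (2 * (n * ε ^ 2)⁻¹) :=
    measure_lintegral_likelihoodRatio_lt_le hf hf₀ prior hε hn hKL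
  have hb2 : Q (⋃ i, (G i)ᶜ) ≤ ENNReal.ofReal (Fintype.card ι * E) := by
    refine (measure_iUnion_fintype_le Q _).trans ?_
    refine (Finset.sum_le_sum (g := fun _ => ENNReal.ofReal E) fun i _ =>
      measure_compl_countBelow_le (hS i) hε (hw i) hc hV (hvar i) n).trans (le_of_eq ?_)
    rw [Finset.sum_const, Finset.card_univ, nsmul_eq_mul, ENNReal.ofReal_mul (by positivity),
        ENNReal.ofReal_natCast]
  have hb3 : Q {x | ENNReal.ofReal (η * d) ≤ H x} ≤
      ENNReal.ofReal (Fintype.card ι * E / (η * d)) := by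
    refine (meas_ge_le_lintegral_div hHm.aemeasurable (by simpa using mul_pos hη hd0)
      ENNReal.ofReal_ne_top).trans ?_
    rw [ENNReal.ofReal_div_of_pos (mul_pos hη hd0)]
    gcongr
  refine (measure_mono hsub).trans ((measure_union_le _ _).trans ?_)
  refine (add_le_add ((measure_union_le _ _).trans (add_le_add hb1 hb2)) hb3).trans ?_
  rw [ENNReal.ofReal_add (by positivity) (by positivity),
    ENNReal.ofReal_add (by positivity) (by positivity)]

/-! ### Grid half-lines and the cover of Wasserstein superlevel sets -/

theorem secondMoment_le_one_add_absMoment {P : Measure ℝ} [IsProbabilityMeasure P] {δ : ℝ}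
    (hδ : 0 < δ) : secondMoment P ≤ 1 + absMoment (2 + δ) P := by
  have h1 : (1 : ℝ≥0∞) = ∫⁻ _, 1 ∂P := by simp
  rw [absMoment, h1, ← lintegral_add_left measurable_const]
  refine lintegral_mono fun x => ?_
  rw [← ENNReal.ofReal_one, ← ENNReal.ofReal_add zero_le_one (by positivity)]
  refine ENNReal.ofReal_le_ofReal ?_
  rcases le_total |x| 1 with h | h
  · have : x ^ 2 ≤ 1 := (sq_le_one_iff_abs_le_one x).2 h
    have : 0 ≤ |x| ^ (2 + δ) := by positivity
    linarith
  · have h2 : |x| ^ (2 : ℝ) ≤ |x| ^ (2 + δ) := Real.rpow_le_rpow_of_exponent_le h (by linarith)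
    rw [Real.rpow_two, sq_abs] at h2
    linarith

/-- Chebyshev bounds the variance times `y²` by `V`; with the trivial bound `1` and `(1 + y)² ≤ 2(1
+ y²)` this covers small and large `y` at once. -/
theorem measureReal_mul_one_sub_le {P : Measure ℝ} [IsProbabilityMeasure P] {V : ℝ} (hV : 0 ≤ V)
    (hP : secondMoment P ≤ ENNReal.ofReal V) {y : ℝ} (hy : 0 ≤ y) {S : Set ℝ}
    (hS : MeasurableSet S) (h : (∀ z ∈ S, y ^ 2 ≤ z ^ 2) ∨ ∀ z ∈ Sᶜ, y ^ 2 ≤ z ^ 2) :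
    P.real S * (1 - P.real S) ≤ 2 * (1 + V) * (1 / (1 + y)) ^ 2 := by
  have h0 : 0 ≤ P.real S := measureReal_nonneg
  have h1 : P.real S ≤ 1 := measureReal_le_one
  set p := P.real S with hp
  have hkey : p * (1 - p) * y ^ 2 ≤ V := by
    rcases eq_or_lt_of_le hy with rfl | hy
    · simpa using hV
    · have hpos : 0 < y ^ 2 := by positivity
      rw [← le_div_iff₀ hpos]
      rcases h with h | h
      · have := measureReal_le_secondMoment_div hV hP hy.ne' h
        nlinarith
      · have := measureReal_le_secondMoment_div hV hP hy.ne' h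
        rw [probReal_compl_eq_one_sub hS] at this
        nlinarith
  have h2 : p * (1 - p) * (1 + y) ^ 2 ≤ 2 * (1 + V) := by
    have h3 : 0 ≤ p * (1 - p) := mul_nonneg h0 (by linarith)
    have h4 : p * (1 - p) ≤ 1 := by nlinarith
    have h5 : (1 + y) ^ 2 ≤ 2 * (1 + y ^ 2) := by nlinarith [sq_nonneg (1 - y)]
    nlinarith [mul_le_mul_of_nonneg_left h5 h3]
  rw [one_div, inv_pow, ← div_eq_mul_inv, le_div_iff₀ (by positivity)]
  exact h2

/-- The half-lines with endpoints in the grid `{± k ε}`. -/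
def gridHalfLine (ε : ℝ) {m : ℕ} (i : Fin m × Bool × Bool) : Set ℝ :=
  let a : ℝ := if i.2.1 then i.1 * ε else -(i.1 * ε)
  if i.2.2 then Set.Iic a else (Set.Iic a)ᶜ

theorem measurableSet_gridHalfLine (ε : ℝ) {m : ℕ} (i : Fin m × Bool × Bool) :
    MeasurableSet (gridHalfLine ε i) := by
  unfold gridHalfLine
  dsimp only
  split_ifs <;> measurability

theorem sq_le_sq_of_mem_gridHalfLine {ε : ℝ} (hε : 0 ≤ ε) {m : ℕ} (i : Fin m × Bool × Bool) :
    (∀ z ∈ gridHalfLine ε i, ((i.1 : ℝ) * ε) ^ 2 ≤ z ^ 2) ∨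
      ∀ z ∈ (gridHalfLine ε i)ᶜ, ((i.1 : ℝ) * ε) ^ 2 ≤ z ^ 2 := by
  have h0 : 0 ≤ (i.1 : ℝ) * ε := by positivity
  have h1 : (∀ z ∈ Set.Iic (if i.2.1 then (i.1 : ℝ) * ε else -(i.1 * ε)),
      ((i.1 : ℝ) * ε) ^ 2 ≤ z ^ 2) ∨
      ∀ z ∈ (Set.Iic (if i.2.1 then (i.1 : ℝ) * ε else -(i.1 * ε)))ᶜ,
      ((i.1 : ℝ) * ε) ^ 2 ≤ z ^ 2 := by
    split_ifs
    · refine Or.inr fun z hz => ?_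
      have : (i.1 : ℝ) * ε < z := not_le.1 hz
      nlinarith
    · refine Or.inl fun z hz => ?_
      have : z ≤ -((i.1 : ℝ) * ε) := hz
      nlinarith
  unfold gridHalfLine
  dsimp only
  by_cases h : i.2.2
  · simpa only [h, if_true] using h1
  · simpa only [h, if_false, compl_compl, Bool.false_eq_true] using h1.symm

/-- Excess mass is one-sided; an excess on the complementary half-line is a deficit of the
distribution function, so the two together bound the modulus. -/
theorem abs_cdf_sub_le_of_notMem_excessMass {P₀ : Measure ℝ} [IsProbabilityMeasure P₀] {ε V t : ℝ}
    {m : ℕ} {P : F} (k : Fin m) (b : Bool)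
    (hvar : ∀ b', ((P : ProbabilityMeasure ℝ) : Measure ℝ).real (gridHalfLine ε (k, b, b')) *
      (1 - ((P : ProbabilityMeasure ℝ) : Measure ℝ).real (gridHalfLine ε (k, b, b'))) ≤ V)
    (h : ∀ b', P ∉ excessMass F P₀ (gridHalfLine ε (k, b, b')) V t) :
    |cdf ((P : ProbabilityMeasure ℝ) : Measure ℝ) (if b then k * ε else -(k * ε)) -
      cdf P₀ (if b then k * ε else -(k * ε))| ≤ 2 * t := by
  have h1 := fun b' => not_le.1 fun h2 => h b' ⟨hvar b', h2⟩
  have ht := h1 true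
  have hf := h1 false
  simp only [gridHalfLine, if_true, Bool.false_eq_true, if_false,
    probReal_compl_eq_one_sub measurableSet_Iic, ← cdf_eq_real] at ht hf
  exact abs_le.2 ⟨by linarith, by linarith⟩

theorem wasserstein_superlevel_subset (P₀ : Measure ℝ) [IsProbabilityMeasure P₀] {V c ε : ℝ}
    (hV : 0 ≤ V) (hc : 0 ≤ c) (hε : 0 < ε) (hε1 : ε ≤ Real.exp (-1))
    (hP₀ : secondMoment P₀ ≤ ENNReal.ofReal V) :
    {P : F | secondMoment ((P : ProbabilityMeasure ℝ) : Measure ℝ) ≤ ENNReal.ofReal V ∧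
      ENNReal.ofReal ((2 * (16 * (2 * c) + 1 + V) + 1) * ε * Real.log ε⁻¹) ≤
        wasserstein 1 ((P : ProbabilityMeasure ℝ) : Measure ℝ) P₀} ⊆
    ⋃ i : Fin (⌈(ε ^ 2)⁻¹⌉₊ + 1) × Bool × Bool, excessMass F P₀ (gridHalfLine ε i)
      (2 * (1 + V) * (1 / (1 + i.1 * ε)) ^ 2) (c * (ε * (1 / (1 + i.1 * ε)) + ε ^ 2)) := by
  rintro P ⟨hP, hW⟩
  have hWle := wasserstein_one_le_of_grid (P := ((P : ProbabilityMeasure ℝ) : Measure ℝ))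
    hV (mul_nonneg zero_le_two hc) hε hε1 hP hP₀
  generalize ⌈(ε ^ 2)⁻¹⌉₊ = m at hWle ⊢
  by_contra hnot
  simp only [Set.mem_iUnion, not_exists] at hnot
  have hgrid : ∀ k ≤ m, ∀ b : Bool,
      |cdf ((P : ProbabilityMeasure ℝ) : Measure ℝ) (if b then k * ε else -(k * ε)) -
        cdf P₀ (if b then k * ε else -(k * ε))| ≤ 2 * c * (ε / (1 + k * ε) + ε ^ 2) := by
    intro k hk b
    set j : Fin (m + 1) := ⟨k, Nat.lt_succ_of_le hk⟩ with hj
    have h := abs_cdf_sub_le_of_notMem_excessMass (P₀ := P₀) (ε := ε) (P := P)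
      (V := 2 * (1 + V) * (1 / (1 + (j : ℕ) * ε)) ^ 2)
      (t := c * (ε * (1 / (1 + (j : ℕ) * ε)) + ε ^ 2)) j b
      (fun b' => measureReal_mul_one_sub_le (y := (j : ℕ) * ε) hV hP (by positivity)
        (measurableSet_gridHalfLine ε _) (sq_le_sq_of_mem_gridHalfLine hε.le (j, b, b')))
      (fun b' => hnot (j, b, b'))
    rw [mul_one_div, ← mul_assoc] at h
    exact h
  have hle := hWle
    (fun k hk => by simpa using hgrid k hk true) (fun k hk => by simpa using hgrid k hk false)
  have hl : 0 < Real.log ε⁻¹ :=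
    Real.log_pos ((one_lt_inv₀ hε).2 (hε1.trans_lt (by simp)))
  -- The extra `+ 1` in the constant makes the two bounds on the distance incompatible.
  have h1 := (ENNReal.ofReal_le_ofReal_iff (by positivity)).1 (hW.trans hle)
  have h2 : 0 < ε * Real.log ε⁻¹ := by positivity
  nlinarith

/-! ### Error probabilities and the final assembly -/

/-- As `T = nε² ≥ log n ≥ 1`, the number of half-lines is at most `12n`. Dividing `exp(-6T)` by the
denominator bound leaves `exp(-3T) ≤ n⁻²`, which beats that number. -/
theorem error_bound_le {n m : ℕ} {ε η : ℝ} (hη : 0 < η) (hlog : 1 ≤ Real.log n)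
    (hε : 0 < ε) (hT : Real.log n ≤ n * ε ^ 2) (hm : m = 4 * (⌈(ε ^ 2)⁻¹⌉₊ + 1)) :
    2 * (n * ε ^ 2)⁻¹ + m * Real.exp (-(n * (6 * ε ^ 2))) +
        m * Real.exp (-(n * (6 * ε ^ 2))) / (η * (Real.exp (-(3 * (n * ε ^ 2))) / 2)) ≤
      2 * (Real.log n)⁻¹ + (1 + 2 / η) * (12 * (n : ℝ)⁻¹) := by
  have hn : 0 < (n : ℝ) := by
    rcases Nat.eq_zero_or_pos n with rfl | h
    · norm_num at hlog
    · exact_mod_cast h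
  have hn1 : 1 ≤ (n : ℝ) := by exact_mod_cast hn
  set T := n * ε ^ 2 with hTdef
  have hm' : (m : ℝ) ≤ 12 * n := by
    have h1 := Nat.ceil_lt_add_one (show 0 ≤ (ε ^ 2)⁻¹ by positivity)
    have h2 : (ε ^ 2)⁻¹ ≤ n := by
      rw [inv_le_iff_one_le_mul₀ (by positivity)]
      linarith
    rw [hm]
    push_cast
    linarith
  have he6 : Real.exp (-(n * (6 * ε ^ 2))) = Real.exp (-(3 * T)) * Real.exp (-(3 * T)) := by
    rw [← Real.exp_add]
    congr 1
    rw [hTdef]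
    ring
  have he : (m : ℝ) * Real.exp (-(3 * T)) ≤ 12 * (n : ℝ)⁻¹ := by
    have h3 : Real.exp (-(3 * T)) ≤ (n : ℝ)⁻¹ * (n : ℝ)⁻¹ := by
      calc Real.exp (-(3 * T)) ≤ Real.exp (-Real.log n + -Real.log n) :=
            Real.exp_le_exp.2 (by linarith)
        _ = (n : ℝ)⁻¹ * (n : ℝ)⁻¹ := by
            rw [Real.exp_add, ← Real.log_inv, Real.exp_log (by positivity)]
    calc (m : ℝ) * Real.exp (-(3 * T)) ≤ 12 * n * ((n : ℝ)⁻¹ * (n : ℝ)⁻¹) := by gcongr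
      _ = 12 * (n : ℝ)⁻¹ := by field_simp
  have hE1 : Real.exp (-(3 * T)) ≤ 1 := Real.exp_le_one_iff.2 (by linarith)
  have hE0 := Real.exp_pos (-(3 * T))
  set E := Real.exp (-(3 * T)) with hE
  have hi : T⁻¹ ≤ (Real.log n)⁻¹ := inv_anti₀ (by linarith) hT
  have h4 : m * (E * E) ≤ m * E := by
    gcongr
    exact mul_le_of_le_one_left hE0.le hE1
  have h5 : m * (E * E) / (η * (E / 2)) = 2 / η * (m * E) := by field_simp
  rw [he6, h5]
  have h6 : 2 / η * (m * E) ≤ 2 / η * (12 * (n : ℝ)⁻¹) := by gcongr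
  linarith

theorem tendsto_error_bound (η : ℝ) :
    Tendsto (fun n : ℕ => ENNReal.ofReal
      (2 * (Real.log n)⁻¹ + (1 + 2 / η) * (12 * (n : ℝ)⁻¹))) atTop (𝓝 0) := by
  rw [← ENNReal.ofReal_zero]
  refine (ENNReal.continuous_ofReal.tendsto 0).comp ?_
  have h1 : Tendsto (fun n : ℕ => (Real.log n)⁻¹) atTop (𝓝 0) :=
    (Real.tendsto_log_atTop.comp tendsto_natCast_atTop_atTop).inv_tendsto_atTop
  have h2 : Tendsto (fun n : ℕ => (n : ℝ)⁻¹) atTop (𝓝 0) := tendsto_inv_atTop_nhds_zero_nat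
  simpa using (h1.const_mul 2).add ((h2.const_mul 12).const_mul (1 + 2 / η))

theorem measurableSet_absMoment_le (q : ℝ) (C : ℝ≥0∞) :
    MeasurableSet {P : F | absMoment q ((P : ProbabilityMeasure ℝ) : Measure ℝ) ≤ C} :=
  measurableSet_le
    ((Measure.measurable_lintegral (by fun_prop)).comp measurable_coe_measure) measurable_const

/-- If the posterior mass of `M` is close to one, the posterior mass of `B` is small as soon as the
numerator of that of `B ∩ M` is. -/
theorem posterior_lt_of_inter {f : F → ℝ → ℝ} {f₀ : ℝ → ℝ} {prior : Measure F} {n : ℕ}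
    {x : Fin n → ℝ} {M B : Set F} (hM : MeasurableSet M) {η : ℝ} (hη : 0 < η) (hη1 : η < 1)
    (h1 : |posterior f f₀ prior x M - 1| < η)
    (h2 : ∫⁻ P in B ∩ M, likelihoodRatio f f₀ x P ∂prior <
      ENNReal.ofReal η * ∫⁻ P, likelihoodRatio f f₀ x P ∂prior) :
    posterior f f₀ prior x B < 2 * η := by
  unfold posterior at h1 ⊢
  set D := ∫⁻ P, likelihoodRatio f f₀ x P ∂prior with hD
  have hsum : ∫⁻ P in M, likelihoodRatio f f₀ x P ∂prior +
      ∫⁻ P in Mᶜ, likelihoodRatio f f₀ x P ∂prior = D := lintegral_add_compl _ hM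
  set a := ∫⁻ P in M, likelihoodRatio f f₀ x P ∂prior with ha
  set b := ∫⁻ P in Mᶜ, likelihoodRatio f f₀ x P ∂prior with hb
  set e := ∫⁻ P in B ∩ M, likelihoodRatio f f₀ x P ∂prior with he
  -- Degenerate denominators are excluded: `D = 0` contradicts the strict inequality `h2`, and `D =
  -- ∞` would make the quotient zero, far from one.
  have hne : (a / D).toReal ≠ 0 := by
    intro h0
    rw [h0] at h1
    norm_num at h1
    linarith
  have hD0 : D ≠ 0 := by
    intro h0
    rw [h0] at h2
    simp at h2
  have hDt : D ≠ ∞ := by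
    intro h0
    rw [h0] at hne
    simp at hne
  have hat : a ≠ ∞ := ne_top_of_le_ne_top hDt (hsum ▸ le_self_add)
  have hbt : b ≠ ∞ := ne_top_of_le_ne_top hDt (hsum ▸ le_add_self)
  have het : e ≠ ∞ := ne_top_of_lt h2
  have hBle : ∫⁻ P in B, likelihoodRatio f f₀ x P ∂prior ≤ e + b := by
    refine (lintegral_mono_set (t := B ∩ M ∪ Mᶜ) fun P hP => ?_).trans (lintegral_union_le _ _ _)
    by_cases h : P ∈ M
    · exact Or.inl ⟨hP, h⟩
    · exact Or.inr h
  have hDpos : 0 < D.toReal := ENNReal.toReal_pos hD0 hDt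
  have hsumr : a.toReal + b.toReal = D.toReal := by
    rw [← hsum, ENNReal.toReal_add hat hbt]
  have her : e.toReal < η * D.toReal := by
    have := ENNReal.toReal_strict_mono (ENNReal.mul_ne_top ENNReal.ofReal_ne_top hDt) h2
    rwa [ENNReal.toReal_mul, ENNReal.toReal_ofReal hη.le] at this
  have hBr : (∫⁻ P in B, likelihoodRatio f f₀ x P ∂prior).toReal ≤ e.toReal + b.toReal := by
    rw [← ENNReal.toReal_add het hbt]
    exact ENNReal.toReal_mono (ENNReal.add_ne_top.2 ⟨het, hbt⟩) hBle
  have h3 := (abs_lt.1 h1).1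
  rw [ENNReal.toReal_div] at h3 ⊢
  have h4 : (1 - η) * D.toReal < a.toReal := by
    rw [← lt_div_iff₀ hDpos]
    linarith
  rw [div_lt_iff₀ hDpos]
  linarith

end

end PosteriorRate

open PosteriorRate in
theorem mainTheorem2
    -- the true distribution, with its Lebesgue density
    (P₀ : Measure ℝ) [IsProbabilityMeasure P₀] (f₀ : ℝ → ℝ) (hf₀ : PosteriorRate.IsDensity f₀ P₀)
    -- the model and the (sample size dependent) prior
    (F : Set (ProbabilityMeasure ℝ)) (f : F → ℝ → ℝ) (hf : PosteriorRate.IsDensityFamily f)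
    (prior : ℕ → Measure F) [∀ n, IsProbabilityMeasure (prior n)]
    -- the i.i.d. observations; those of the n-th experiment are X 0, ..., X (n - 1)
    {Ω : Type*} [MeasurableSpace Ω] (μ : Measure Ω) [IsProbabilityMeasure μ] (X : ℕ → Ω → ℝ)
    (hX : ∀ i, HasLaw (X i) P₀ μ) (hXindep : iIndepFun X μ)
    -- the rate
    (ε : ℕ → ℝ) (hε_anti : AntitoneOn ε (Set.Ici 1)) (hε_lim : Tendsto ε atTop (𝓝 0))
    (hε_ge : ∀ n : ℕ, 1 ≤ n → √(Real.log n / n) ≤ ε n)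
    (hKL : PosteriorRate.KLRateCondition f P₀ f₀ prior ε)
    -- the moment conditions
    (K δ : ℝ) (hK : 0 < K) (hδ : 0 < δ) (hP₀ : PosteriorRate.absMoment (2 + δ) P₀ < ∞)
    (hpost : TendstoInMeasure μ
      (fun (n : ℕ) ω => PosteriorRate.posterior f f₀ (prior n) (fun i : Fin n => X i ω)
        {P | PosteriorRate.absMoment (2 + δ) ((P : ProbabilityMeasure ℝ) : Measure ℝ)
          ≤ ENNReal.ofReal K})
      atTop (fun _ => 1)) :
    ∃ K' : ℝ, 0 < K' ∧ TendstoInMeasure μ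
      (fun (n : ℕ) ω => PosteriorRate.posterior f f₀ (prior n) (fun i : Fin n => X i ω)
        {P | ENNReal.ofReal (K' * ε n * Real.log (ε n)⁻¹)
          ≤ PosteriorRate.wasserstein 1 ((P : ProbabilityMeasure ℝ) : Measure ℝ) P₀})
      atTop (fun _ => 0) := by
  set V : ℝ := 1 + K + (absMoment (2 + δ) P₀).toReal with hV
  have hV0 : 0 ≤ V := by positivity
  have hP₀V : secondMoment P₀ ≤ ENNReal.ofReal V := by
    refine (secondMoment_le_one_add_absMoment hδ).trans ?_
    rw [← ENNReal.ofReal_one, ← ENNReal.ofReal_toReal hP₀.ne,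
      ← ENNReal.ofReal_add zero_le_one ENNReal.toReal_nonneg]
    exact ENNReal.ofReal_le_ofReal (by linarith)
  set M : Set F := {P | absMoment (2 + δ) ((P : ProbabilityMeasure ℝ) : Measure ℝ)
    ≤ ENNReal.ofReal K} with hM
  have hMm : MeasurableSet M := measurableSet_absMoment_le _ _
  have hMV : ∀ P ∈ M, secondMoment ((P : ProbabilityMeasure ℝ) : Measure ℝ) ≤
      ENNReal.ofReal V := by
    intro P hP
    refine (secondMoment_le_one_add_absMoment hδ).trans
      ((add_le_add le_rfl (show _ ≤ ENNReal.ofReal K from hP)).trans ?_)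
    rw [← ENNReal.ofReal_one, ← ENNReal.ofReal_add zero_le_one hK.le]
    refine ENNReal.ofReal_le_ofReal ?_
    have : 0 ≤ (absMoment (2 + δ) P₀).toReal := ENNReal.toReal_nonneg
    linarith
  -- The variance constant is `2(1 + V)`; the surplus `6` is twice the exponent `3` of the
  -- denominator bound.
  set c : ℝ := 2 * (1 + V) + 6 with hc
  have hc0 : 0 ≤ c := by positivity
  refine ⟨2 * (16 * (2 * c) + 1 + V) + 1, by positivity, ?_⟩
  set A : ℕ → Set F := fun n =>
    {P | ENNReal.ofReal ((2 * (16 * (2 * c) + 1 + V) + 1) * ε n * Real.log (ε n)⁻¹)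
      ≤ wasserstein 1 ((P : ProbabilityMeasure ℝ) : Measure ℝ) P₀} with hA
  rw [tendstoInMeasure_iff_norm] at hpost ⊢
  intro η hη
  set η' : ℝ := min (η / 2) (1 / 2) with hη'
  have hη'0 : 0 < η' := by positivity
  have hη'1 : η' < 1 := (min_le_right _ _).trans_lt (by norm_num)
  have hη'2 : 2 * η' ≤ η := by linarith [min_le_left (η / 2) (1 / 2)]
  have hlim := (hpost η' hη'0).add (tendsto_error_bound η')
  rw [add_zero] at hlim
  refine tendsto_of_tendsto_of_tendsto_of_le_of_le' tendsto_const_nhds hlim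
    (Eventually.of_forall fun _ => zero_le) ?_
  have hlog : ∀ᶠ n : ℕ in atTop, 1 ≤ Real.log n :=
    (Real.tendsto_log_atTop.comp tendsto_natCast_atTop_atTop).eventually_ge_atTop 1
  filter_upwards [hKL, hlog, eventually_ge_atTop 1,
    hε_lim.eventually_le_const (Real.exp_pos (-1))] with n hKLn hlogn hn hεn1
  have hn0 : (0 : ℝ) < n := by exact_mod_cast hn
  have hεn : 0 < ε n := lt_of_lt_of_le (Real.sqrt_pos.2 (by positivity)) (hε_ge n hn)
  have hT : Real.log n ≤ n * ε n ^ 2 := by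
    have := (Real.sqrt_le_left hεn.le).1 (hε_ge n hn)
    rw [div_le_iff₀ hn0] at this
    linarith
  have hbound := measure_mul_lintegral_le_setLIntegral_le hf hf₀ (prior n) hεn hn hKLn
    (fun i : Fin (⌈(ε n ^ 2)⁻¹⌉₊ + 1) × Bool × Bool => measurableSet_gridHalfLine (ε n) i)
    (w := fun i => 1 / (1 + i.1 * ε n)) (fun i => by positivity) (V := 2 * (1 + V)) (c := c)
    hc0 (by positivity)
    (fun i => measureReal_mul_one_sub_le hV0 hP₀V (by positivity)
      (measurableSet_gridHalfLine (ε n) i) (sq_le_sq_of_mem_gridHalfLine hεn.le i))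
    (A := A n ∩ M) (fun P hP => wasserstein_superlevel_subset P₀ hV0 hc0 hεn hεn1 hP₀V
      ⟨hMV P hP.2, hP.1⟩) hη'0
  rw [show c - 2 * (1 + V) = 6 by rw [hc]; ring] at hbound
  have herr := hbound.trans (ENNReal.ofReal_le_ofReal (error_bound_le hη'0 hlogn hεn hT
    (by simp [Fintype.card_prod]; ring)))
  have hmap : μ.map (fun ω (i : Fin n) => X i ω) = Measure.pi fun _ => P₀ := by
    rw [iIndepFun.map_fun_eq_pi_map (f := fun (i : Fin n) => X i)
      (fun i => (hX i).aemeasurable) (hXindep.precomp Fin.val_injective)]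
    simp only [(hX _).map_eq]
  have hXm : AEMeasurable (fun ω (i : Fin n) => X i ω) μ :=
    aemeasurable_pi_lambda _ fun i => (hX i).aemeasurable
  -- The event is not shown to be measurable, but the inequality `Measure.le_map_apply` suffices to
  -- pull the bound back to `Ω`.
  rw [← hmap] at herr
  refine (measure_mono fun ω hω => ?_).trans ((measure_union_le _ _).trans
    (add_le_add le_rfl ((Measure.le_map_apply hXm _).trans herr)))
  by_contra hnot
  rw [Set.mem_union, not_or] at hnot
  have h1 : |posterior f f₀ (prior n) (fun i : Fin n => X i ω) M - 1| < η' := not_le.1 hnot.1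
  have h2 : ∫⁻ P in A n ∩ M, likelihoodRatio f f₀ (fun i : Fin n => X i ω) P ∂prior n <
      ENNReal.ofReal η' * ∫⁻ P, likelihoodRatio f f₀ (fun i : Fin n => X i ω) P ∂prior n :=
    not_le.1 hnot.2
  refine absurd (show η ≤ ‖_‖ from hω) (not_le.2 ?_)
  rw [sub_zero, PosteriorRate.posterior, Real.norm_of_nonneg ENNReal.toReal_nonneg]
  exact (posterior_lt_of_inter hMm hη'0 hη'1 h1 h2).trans_le hη'2
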